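/- Let $\mathbb K$ be an algebraically closed field and $V$ a $\mathbb K$-vector space of finite positive dimension; write $I$ for the identity map of $V$. A *tridiagonal pair* on $V$ is an ordered pair $A,A^*$ of linear maps $V\to V$ such that (i) $A$ and $A^*$ are diagonalizable; (ii) the eigenspaces of $A$ have a *standard* ordering $V_0,\dots,V_d$, meaning $A^*V_i\subseteq V_{i-1}+V_i+V_{i+1}$ for $0\le i\le d$ (with $V_{-1}=V_{d+1}=0$); (iii) the eigenspaces of $A^*$ have a standard ordering $V^*_0,\dots,V^*_\delta$, meaning $AV^*_i\subseteq V^*_{i-1}+V^*_i+V^*_{i+1}$ for $0\le i\le\delta$ (with $V^*_{-1}=V^*_{\delta+1}=0$); (iv) no subspace $W\neq 0,V$ satisfies $AW\subseteq W$ and $A^*W\subseteq W$. A *tridiagonal system* of diameter $d$ is a sequence $\Phi=(A;\{E_i\}_{i=0}^d;A^*;\{E^*_i\}_{i=0}^d)$ in which $A,A^*$ is a tridiagonal pair and $E_0,\dots,E_d$ (resp. $E_0^*,\dots,E_d^*$) are the projections of $V$ onto the eigenspaces of $A$ (resp. $A^*$), along the sum of the other eigenspaces, taken in a standard ordering. Let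 $\theta_i$ (resp. $\theta_i^*$) be the eigenvalue of $A$ (resp. $A^*$) on $E_iV$ (resp. $E_i^*V$). Let $\Phi$ be a tridiagonal system on $V$ of diameter $d\ge 1$ and of $q$-Racah type: there are nonzero $q,a,b\in\mathbb K$ with $q^4\ne1$ and $$\theta_i=aq^{d-2i}+a^{-1}q^{2i-d},\qquad \theta^*_i=bq^{d-2i}+b^{-1}q^{2i-d}\qquad(0\le i\le d).$$ For $0\le i\le d$ put $$U_i=(E_0^*V+\cdots+E_i^*V)\cap(E_iV+\cdots+E_dV),\qquad U_i^{\Downarrow}=(E_0^*V+\cdots+E_i^*V)\cap(E_0V+\cdots+E_{d-i}V),$$ and for $0\le i\le d/2$ put $K_i=(E_0^*V+\cdots+E_i^*V)\cap(E_iV+\cdots+E_{d-i}V)$. Let $K$ (resp. $B$) be the linear map $V\to V$ that acts on $U_i$ (resp. $U_i^{\Downarrow}$) as $q^{d-2i}$ times the identity for $0\le i\le d$, put $R=A-aK-a^{-1}K^{-1}$, and let $\psi$ be the linear map $V\to V$ such that $\psi R-R\psi=(q-q^{-1})(K-K^{-1})$ and $\psi K_i=0$ for $0\le i\le d/2$.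 Then $K$, $B$ and $\psi$ exist and are uniquely determined by these conditions, $K$ and $B$ are invertible, and $\psi$ is equal to each of $$\frac{I-BK^{-1}}{q(aI-a^{-1}BK^{-1})},\qquad \frac{I-KB^{-1}}{q(a^{-1}I-aKB^{-1})},\qquad \frac{q(I-K^{-1}B)}{aI-a^{-1}K^{-1}B},\qquad \frac{q(I-B^{-1}K)}{a^{-1}I-aB^{-1}K}.$$ In all four expressions the denominator is invertible; here $N/D$ denotes $ND^{-1}=D^{-1}N$. -/

import Mathlib

/-- `W` is an eigenspace of `A`: it is nonzero and of the form `{v | A v = θ v}`. -/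
def IsEigenspace {𝕜 V : Type*} [Field 𝕜] [AddCommGroup V] [Module 𝕜 V]
    (A : Module.End 𝕜 V) (W : Submodule 𝕜 V) : Prop :=
  W ≠ ⊥ ∧ ∃ θ : 𝕜, W = A.eigenspace θ

/-- `A` is diagonalizable: `V` is spanned by the eigenspaces of `A`. -/
def IsDiagonalizableEnd {𝕜 V : Type*} [Field 𝕜] [AddCommGroup V] [Module 𝕜 V]
    (A : Module.End 𝕜 V) : Prop :=
  sSup {W : Submodule 𝕜 V | IsEigenspace A W} = ⊤

/-- `W 0, …, W d` is an ordering of the eigenspaces of `A` (each one listed exactly once)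
that is standard with respect to `A'`: `A' W_i ⊆ W_{i-1} + W_i + W_{i+1}` for `0 ≤ i ≤ d`,
where `W_{-1} = W_{d+1} = 0`. -/
structure IsStandardOrdering {𝕜 V : Type*} [Field 𝕜] [AddCommGroup V] [Module 𝕜 V]
    (A A' : Module.End 𝕜 V) {d : ℕ} (W : Fin (d + 1) → Submodule 𝕜 V) : Prop where
  injective : Function.Injective W
  range_eq : Set.range W = {X | IsEigenspace A X}
  tridiagonal : ∀ i : Fin (d + 1), (W i).map A' ≤
    ⨆ j : Fin (d + 1), ⨆ _ : (j : ℕ) ≤ (i : ℕ) + 1 ∧ (i : ℕ) ≤ (j : ℕ) + 1, W j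

/-- Tridiagonal pairs on `V` (here `A'` is the map usually written `A^*`). -/
structure IsTDPair {𝕜 V : Type*} [Field 𝕜] [AddCommGroup V] [Module 𝕜 V]
    (A A' : Module.End 𝕜 V) : Prop where
  diagonalizable : IsDiagonalizableEnd A
  diagonalizable' : IsDiagonalizableEnd A'
  exists_ordering : ∃ (d : ℕ) (W : Fin (d + 1) → Submodule 𝕜 V), IsStandardOrdering A A' W
  exists_ordering' : ∃ (δ : ℕ) (W : Fin (δ + 1) → Submodule 𝕜 V), IsStandardOrdering A' A W
  irreducible : ∀ W : Submodule 𝕜 V, W.map A ≤ W → W.map A' ≤ W → W = ⊥ ∨ W = ⊤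

/-- `E 0, …, E d` is a standard ordering (with respect to `A'`) of the primitive idempotents
of `A`: the images `E_i V` are a standard ordering of the eigenspaces of `A`, and `E_i` acts as
the identity on `E_i V` and as zero on `E_j V` for `j ≠ i`. -/
structure IsStandardIdempotents {𝕜 V : Type*} [Field 𝕜] [AddCommGroup V] [Module 𝕜 V]
    (A A' : Module.End 𝕜 V) {d : ℕ} (E : Fin (d + 1) → Module.End 𝕜 V) : Prop where
  standard : IsStandardOrdering A A' (fun i => LinearMap.range (E i))
  apply_self : ∀ i, ∀ v ∈ LinearMap.range (E i), E i v = v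
  apply_ne : ∀ i j, j ≠ i → ∀ v ∈ LinearMap.range (E j), E i v = 0

/-- Tridiagonal systems `(A; {E_i}; A^*; {E_i^*})` on `V` of diameter `d`. -/
structure TDSystem (𝕜 V : Type*) [Field 𝕜] [AddCommGroup V] [Module 𝕜 V] (d : ℕ) where
  A : Module.End 𝕜 V
  E : Fin (d + 1) → Module.End 𝕜 V
  A' : Module.End 𝕜 V
  E' : Fin (d + 1) → Module.End 𝕜 V
  isTDPair : IsTDPair A A'
  idempotents : IsStandardIdempotents A A' E
  idempotents' : IsStandardIdempotents A' A E'

namespace TDSystem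

variable {𝕜 V : Type*} [Field 𝕜] [AddCommGroup V] [Module 𝕜 V] {d : ℕ}

theorem isEigenspace_range (Φ : TDSystem 𝕜 V d) (i : Fin (d + 1)) :
    IsEigenspace Φ.A (LinearMap.range (Φ.E i)) := by
  have h : LinearMap.range (Φ.E i) ∈ Set.range fun i => LinearMap.range (Φ.E i) := ⟨i, rfl⟩
  rw [Φ.idempotents.standard.range_eq] at h
  exact h

theorem isEigenspace_range' (Φ : TDSystem 𝕜 V d) (i : Fin (d + 1)) :
    IsEigenspace Φ.A' (LinearMap.range (Φ.E' i)) := by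
  have h : LinearMap.range (Φ.E' i) ∈ Set.range fun i => LinearMap.range (Φ.E' i) := ⟨i, rfl⟩
  rw [Φ.idempotents'.standard.range_eq] at h
  exact h

/-- The eigenvalue `θ_i` of `A` associated with `E_i`. -/
noncomputable def theta (Φ : TDSystem 𝕜 V d) (i : Fin (d + 1)) : 𝕜 :=
  (Φ.isEigenspace_range i).2.choose

/-- The eigenvalue `θ_i^*` of `A^*` associated with `E_i^*`. -/
noncomputable def theta' (Φ : TDSystem 𝕜 V d) (i : Fin (d + 1)) : 𝕜 :=
  (Φ.isEigenspace_range' i).2.choose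

theorem range_eq_eigenspace (Φ : TDSystem 𝕜 V d) (i : Fin (d + 1)) :
    LinearMap.range (Φ.E i) = Φ.A.eigenspace (Φ.theta i) :=
  (Φ.isEigenspace_range i).2.choose_spec

theorem range_eq_eigenspace' (Φ : TDSystem 𝕜 V d) (i : Fin (d + 1)) :
    LinearMap.range (Φ.E' i) = Φ.A'.eigenspace (Φ.theta' i) :=
  (Φ.isEigenspace_range' i).2.choose_spec

/-- `Φ` has `q`-Racah type, with parameters `q, a, b`. -/
structure IsQRacah (Φ : TDSystem 𝕜 V d) (q a b : 𝕜) : Prop where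
  q_ne_zero : q ≠ 0
  a_ne_zero : a ≠ 0
  b_ne_zero : b ≠ 0
  q_pow_four_ne_one : q ^ 4 ≠ 1
  theta_eq : ∀ i : Fin (d + 1),
    Φ.theta i = a * q ^ ((d : ℤ) - 2 * (i : ℤ)) + a⁻¹ * q ^ (2 * (i : ℤ) - (d : ℤ))
  theta'_eq : ∀ i : Fin (d + 1),
    Φ.theta' i = b * q ^ ((d : ℤ) - 2 * (i : ℤ)) + b⁻¹ * q ^ (2 * (i : ℤ) - (d : ℤ))

/-- The first split decomposition:
`U_i = (E_0^* V + ⋯ + E_i^* V) ∩ (E_i V + ⋯ + E_d V)`. -/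
def U (Φ : TDSystem 𝕜 V d) (i : Fin (d + 1)) : Submodule 𝕜 V :=
  (⨆ j : Fin (d + 1), ⨆ _ : j ≤ i, LinearMap.range (Φ.E' j)) ⊓
    (⨆ j : Fin (d + 1), ⨆ _ : i ≤ j, LinearMap.range (Φ.E j))

/-- The second split decomposition:
`U_i^⇓ = (E_0^* V + ⋯ + E_i^* V) ∩ (E_0 V + ⋯ + E_{d-i} V)`. -/
def Udd (Φ : TDSystem 𝕜 V d) (i : Fin (d + 1)) : Submodule 𝕜 V :=
  (⨆ j : Fin (d + 1), ⨆ _ : j ≤ i, LinearMap.range (Φ.E' j)) ⊓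
    (⨆ j : Fin (d + 1), ⨆ _ : (j : ℕ) + (i : ℕ) ≤ d, LinearMap.range (Φ.E j))

/-- `K_i = (E_0^* V + ⋯ + E_i^* V) ∩ (E_i V + ⋯ + E_{d-i} V)`, used for `0 ≤ i ≤ d/2` only. -/
def Ksub (Φ : TDSystem 𝕜 V d) (i : ℕ) : Submodule 𝕜 V :=
  (⨆ j : Fin (d + 1), ⨆ _ : (j : ℕ) ≤ i, LinearMap.range (Φ.E' j)) ⊓
    (⨆ j : Fin (d + 1), ⨆ _ : i ≤ (j : ℕ) ∧ (j : ℕ) + i ≤ d, LinearMap.range (Φ.E j))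

/-- The defining property of `K`: `(K - q^{d-2i} I) U_i = 0` for `0 ≤ i ≤ d`. -/
def IsK (Φ : TDSystem 𝕜 V d) (q : 𝕜) (X : Module.End 𝕜 V) : Prop :=
  ∀ i : Fin (d + 1), ∀ v ∈ Φ.U i, X v = q ^ ((d : ℤ) - 2 * (i : ℤ)) • v

/-- The defining property of `B`: `(B - q^{d-2i} I) U_i^⇓ = 0` for `0 ≤ i ≤ d`. -/
def IsB (Φ : TDSystem 𝕜 V d) (q : 𝕜) (X : Module.End 𝕜 V) : Prop :=
  ∀ i : Fin (d + 1), ∀ v ∈ Φ.Udd i, X v = q ^ ((d : ℤ) - 2 * (i : ℤ)) • v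

/-- The map `K`, i.e. the linear map with the property `IsK`
(its existence and uniqueness are not part of this definition). -/
noncomputable def K (Φ : TDSystem 𝕜 V d) (q : 𝕜) : Module.End 𝕜 V :=
  Classical.epsilon (Φ.IsK q)

/-- The map `B`, i.e. the linear map with the property `IsB`
(its existence and uniqueness are not part of this definition). -/
noncomputable def B (Φ : TDSystem 𝕜 V d) (q : 𝕜) : Module.End 𝕜 V :=
  Classical.epsilon (Φ.IsB q)

/-- The raising map `R = A - a K - a⁻¹ K⁻¹`. -/
noncomputable def R (Φ : TDSystem 𝕜 V d) (q a : 𝕜) : Module.End 𝕜 V :=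
  Φ.A - a • Φ.K q - a⁻¹ • Ring.inverse (Φ.K q)

/-- The defining property of the double lowering map `ψ`:
`ψ R - R ψ = (q - q⁻¹)(K - K⁻¹)`, and `ψ K_i = 0` for `0 ≤ i ≤ d/2`. -/
def IsPsi (Φ : TDSystem 𝕜 V d) (q a : 𝕜) (X : Module.End 𝕜 V) : Prop :=
  X * Φ.R q a - Φ.R q a * X = (q - q⁻¹) • (Φ.K q - Ring.inverse (Φ.K q)) ∧
    ∀ i : ℕ, 2 * i ≤ d → ∀ v ∈ Φ.Ksub i, X v = 0

/-- The double lowering map `ψ`, i.e. the linear map with the property `IsPsi`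
(its existence and uniqueness are not part of this definition). -/
noncomputable def psi (Φ : TDSystem 𝕜 V d) (q a : 𝕜) : Module.End 𝕜 V :=
  Classical.epsilon (Φ.IsPsi q a)

end TDSystem

/-- `x` equals the fraction `N / D` in a (possibly noncommutative) ring: the denominator `D` is
invertible and `x = N D⁻¹ = D⁻¹ N`. -/
structure IsFraction {S : Type*} [Ring S] (x N D : S) : Prop where
  isUnit : IsUnit D
  eq_mul_inverse : x = N * Ring.inverse D
  eq_inverse_mul : x = Ring.inverse D * N

/-!
The flags `E'_0 V + ⋯ + E'_{n-1} V` and `E_n V + ⋯ + E_d V` are complementary: their intersections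
for the various `n`, and likewise the `U_n`, span subspaces invariant under `A` and `A^*`, so
irreducibility decides whether such a span is `0` or `V` (`IsTDData.isCompl_flags`,
`IsTDData.iSup_splitComp`). Hence the `U_n` form a decomposition of `V`, and reversing the order of
the `E_i`, which replaces `a` by `a⁻¹`, gives the same for the `U_n^⇓`. So `K` and `B` exist, are
unique and are invertible.

The raising map `R` sends `U_n` to `U_{n+1}`. Comparing the two decompositions shows that
`R^{d-2n} : U_n → U_{d-n}` is bijective, and therefore the subspaces `K_n` generate `V` under `R`
(`IsTDData.eq_top_of_raising_invariant`). This gives the uniqueness of `ψ`, and is also what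
reduces identities on `V` to identities on the `K_n`, where `K` and `B` act by the same scalar.

Put `C = K - B` and `u = a K - a⁻¹ B`. Both `K` and `B` satisfy a `q`-Weyl type relation with `A`,
and these two relations force the set where `u C = q² C u` holds to propagate from the `K_n` to all
of `V` (`mul_exchange_defect`, `IsTDData.exchange`). The map `u` is invertible, being triangular
on the flag of the `E'_j V` with diagonal entries `(a - a⁻¹) q^{d-2n}`; here `a ≠ a⁻¹` because
`θ_0 ≠ θ_d`. So `ψ = q u⁻¹ C = q⁻¹ C u⁻¹` is well defined. It kills every `K_n` because `C` does,
its commutator with `R` is a formal consequence of the relations (`commutator_of_exchange`), and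
the four fractions are rewritings of `u ψ = q C` and `ψ u = q⁻¹ C`.
-/

/-! ### Resolutions of the identity and tridiagonal data -/

section Supported

variable {𝕜 V : Type*} [Field 𝕜] [AddCommGroup V] [Module 𝕜 V] {d : ℕ}

/-- For a family `E` of mutually orthogonal idempotents with sum `1`, the sum of the images
`E_j V` over the indices `j` satisfying `p`, encoded as the common kernel of the other `E_j`. -/
def supportedOn (E : Fin (d + 1) → Module.End 𝕜 V) (p : Fin (d + 1) → Prop) :
    Submodule 𝕜 V where
  carrier := {v | ∀ j, ¬ p j → E j v = 0}
  add_mem' := fun hx hy j hj => by rw [map_add, hx j hj, hy j hj, add_zero]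
  zero_mem' := fun j _ => map_zero _
  smul_mem' := fun c x hx j hj => by rw [map_smul, hx j hj, smul_zero]

theorem supportedOn_mono {E : Fin (d + 1) → Module.End 𝕜 V} {p p' : Fin (d + 1) → Prop}
    (h : ∀ j, p j → p' j) : supportedOn E p ≤ supportedOn E p' :=
  fun _ hv j hj => hv j fun hp => hj (h j hp)

/-- The data of a tridiagonal system in algebraic form: the primitive idempotents `E_i`, `E'_i`
are resolutions of the identity, and the eigenvalues are given by functions on `ℕ`, of which only
the values at `0, …, d` matter. -/
structure IsTDData (A A' : Module.End 𝕜 V) (E E' : Fin (d + 1) → Module.End 𝕜 V)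
    (θ θ' : ℕ → 𝕜) : Prop where
  sum_eq_one : ∑ i, E i = 1
  sum_eq_one' : ∑ i, E' i = 1
  mul_of_ne : ∀ i j, i ≠ j → E i * E j = 0
  mul_of_ne' : ∀ i j, i ≠ j → E' i * E' j = 0
  mul_eq : ∀ i, E i * A = θ i • E i
  mul_eq' : ∀ i, E' i * A' = θ' i • E' i
  ne_zero : ∀ i, E i ≠ 0
  ne_zero' : ∀ i, E' i ≠ 0
  theta_inj : ∀ i j : Fin (d + 1), θ i = θ j → i = j
  tridiagonal : ∀ i j : Fin (d + 1), (i : ℕ) + 1 < j ∨ (j : ℕ) + 1 < i → E' i * A * E' j = 0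
  tridiagonal' : ∀ i j : Fin (d + 1), (i : ℕ) + 1 < j ∨ (j : ℕ) + 1 < i → E i * A' * E j = 0
  irreducible : ∀ W : Submodule 𝕜 V, W.map A ≤ W → W.map A' ≤ W → W = ⊥ ∨ W = ⊤

theorem sum_apply_of_sum_eq_one {E : Fin (d + 1) → Module.End 𝕜 V} (h : ∑ i, E i = 1) (v : V) :
    ∑ i, E i v = v := by
  rw [← LinearMap.sum_apply, h, Module.End.one_apply]

theorem iSup_range_eq_supportedOn {E : Fin (d + 1) → Module.End 𝕜 V} (h1 : ∑ i, E i = 1)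
    (h0 : ∀ i j, i ≠ j → E i * E j = 0) (p : Fin (d + 1) → Prop) :
    (⨆ j, ⨆ _ : p j, LinearMap.range (E j)) = supportedOn E p := by
  apply le_antisymm
  · refine iSup₂_le fun j hj => ?_
    rintro _ ⟨x, rfl⟩ i hi
    have hij : i ≠ j := fun h => hi (h ▸ hj)
    rw [← Module.End.mul_apply, h0 i j hij, LinearMap.zero_apply]
  · intro v hv
    rw [← sum_apply_of_sum_eq_one h1 v]
    refine Submodule.sum_mem _ fun j _ => ?_
    by_cases hj : p j
    · exact Submodule.mem_iSup_of_mem j (Submodule.mem_iSup_of_mem hj ⟨v, rfl⟩)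
    · rw [hv j hj]; exact Submodule.zero_mem _

theorem isCompl_supportedOn {E : Fin (d + 1) → Module.End 𝕜 V} (h1 : ∑ i, E i = 1)
    (h0 : ∀ i j, i ≠ j → E i * E j = 0) (p : Fin (d + 1) → Prop) :
    IsCompl (supportedOn E p) (supportedOn E fun j => ¬ p j) := by
  constructor
  · rw [Submodule.disjoint_def]
    intro v hv hv'
    rw [← sum_apply_of_sum_eq_one h1 v]
    refine Finset.sum_eq_zero fun j _ => ?_
    by_cases hj : p j
    · exact hv' j (not_not.2 hj)
    · exact hv j hj
  · rw [codisjoint_iff, eq_top_iff]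
    intro v _
    rw [← sum_apply_of_sum_eq_one h1 v]
    refine Submodule.sum_mem _ fun j _ => ?_
    have key : ∀ i, i ≠ j → E i (E j v) = 0 := fun i hi => by
      rw [← Module.End.mul_apply, h0 i j hi, LinearMap.zero_apply]
    by_cases hj : p j
    · exact Submodule.mem_sup_left fun i hi => key i fun h => hi (h ▸ hj)
    · exact Submodule.mem_sup_right fun i hi => key i fun h => hi (h ▸ hj)

/-- A map that is tridiagonal for `E'` can move the support up by at most one index. -/
theorem apply_mem_supportedOn_of_tridiagonal {E : Fin (d + 1) → Module.End 𝕜 V}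
    {X : Module.End 𝕜 V} (h1 : ∑ i, E i = 1) {p p' : Fin (d + 1) → Prop}
    (h : ∀ i j, p j → ¬ p' i → E i * X * E j = 0) {v : V} (hv : v ∈ supportedOn E p) :
    X v ∈ supportedOn E p' := by
  intro i hi
  rw [← sum_apply_of_sum_eq_one h1 v, map_sum, map_sum]
  refine Finset.sum_eq_zero fun j _ => ?_
  by_cases hj : p j
  · exact LinearMap.congr_fun (h i j hj hi) v
  · rw [hv j hj, map_zero, map_zero]

theorem eq_zero_of_mem_supportedOn {E : Fin (d + 1) → Module.End 𝕜 V} (h1 : ∑ i, E i = 1)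
    {p : Fin (d + 1) → Prop} (hp : ∀ j, ¬ p j) {v : V} (hv : v ∈ supportedOn E p) : v = 0 := by
  rw [← sum_apply_of_sum_eq_one h1 v]
  exact Finset.sum_eq_zero fun j _ => hv j (hp j)

end Supported

/-! ### Flags and the split decomposition -/

/-- The sum of the images `E_j V` with `j < n`. -/
def lowFlag {𝕜 V : Type*} [Field 𝕜] [AddCommGroup V] [Module 𝕜 V] {d : ℕ}
    (E : Fin (d + 1) → Module.End 𝕜 V) (n : ℕ) : Submodule 𝕜 V :=
  supportedOn E fun j => (j : ℕ) < n

/-- The sum of the images `E_j V` with `n ≤ j`. -/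
def highFlag {𝕜 V : Type*} [Field 𝕜] [AddCommGroup V] [Module 𝕜 V] {d : ℕ}
    (E : Fin (d + 1) → Module.End 𝕜 V) (n : ℕ) : Submodule 𝕜 V :=
  supportedOn E fun j => n ≤ (j : ℕ)

/-- The `n`-th component `(E'_0 V + ⋯ + E'_n V) ∩ (E_n V + ⋯ + E_d V)` of the split
decomposition; it vanishes for `n > d`. -/
def splitComp {𝕜 V : Type*} [Field 𝕜] [AddCommGroup V] [Module 𝕜 V] {d : ℕ}
    (E E' : Fin (d + 1) → Module.End 𝕜 V) (n : ℕ) : Submodule 𝕜 V :=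
  lowFlag E' (n + 1) ⊓ highFlag E n

namespace IsTDData

variable {𝕜 V : Type*} [Field 𝕜] [AddCommGroup V] [Module 𝕜 V] {d : ℕ}
  {A A' : Module.End 𝕜 V} {E E' : Fin (d + 1) → Module.End 𝕜 V} {θ θ' : ℕ → 𝕜}

/-- Reversing the order of the `E_i` gives tridiagonal data again. -/
theorem rev (h : IsTDData A A' E E' θ θ') {η : ℕ → 𝕜}
    (hη : ∀ i : Fin (d + 1), η i = θ (i.rev : Fin (d + 1))) :
    IsTDData A A' (fun i => E i.rev) E' η θ' where
  sum_eq_one := by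
    rw [← h.sum_eq_one]
    exact Fintype.sum_equiv Fin.revPerm _ _ fun i => rfl
  sum_eq_one' := h.sum_eq_one'
  mul_of_ne i j hij := h.mul_of_ne _ _ fun e => hij (Fin.rev_injective e)
  mul_of_ne' := h.mul_of_ne'
  mul_eq i := by rw [hη]; exact h.mul_eq _
  mul_eq' := h.mul_eq'
  ne_zero i := h.ne_zero _
  ne_zero' := h.ne_zero'
  theta_inj i j e := by
    rw [hη, hη] at e
    exact Fin.rev_injective (h.theta_inj _ _ e)
  tridiagonal := h.tridiagonal
  tridiagonal' i j hij := by
    apply h.tridiagonal'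
    rw [Fin.val_rev, Fin.val_rev]
    omega
  irreducible := h.irreducible

theorem sub_apply_mem_lowFlag (h : IsTDData A A' E E' θ θ') {n : ℕ} (c : 𝕜) {v : V}
    (hv : v ∈ lowFlag E' n) : A v - c • v ∈ lowFlag E' (n + 1) := by
  refine Submodule.sub_mem _ ?_ (Submodule.smul_mem _ _ ?_)
  · exact apply_mem_supportedOn_of_tridiagonal h.sum_eq_one'
      (fun i j hj hi => h.tridiagonal i j (by omega)) hv
  · exact supportedOn_mono (fun j hj => by omega) hv

theorem sub_apply_mem_highFlag (h : IsTDData A A' E E' θ θ') {n : ℕ} {v : V}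
    (hv : v ∈ highFlag E n) : A v - θ n • v ∈ highFlag E (n + 1) := by
  intro j hj
  have e : E j (A v) = θ j • E j v := LinearMap.congr_fun (h.mul_eq j) v
  rw [map_sub, map_smul, e]
  by_cases hjn : n ≤ (j : ℕ)
  · have : (j : ℕ) = n := by omega
    rw [this, sub_self]
  · rw [hv j hjn, smul_zero, smul_zero, sub_zero]

theorem sub_apply_mem_lowFlag' (h : IsTDData A A' E E' θ θ') {n : ℕ} {v : V}
    (hv : v ∈ lowFlag E' (n + 1)) : A' v - θ' n • v ∈ lowFlag E' n := by
  intro j hj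
  have e : E' j (A' v) = θ' j • E' j v := LinearMap.congr_fun (h.mul_eq' j) v
  rw [map_sub, map_smul, e]
  by_cases hjn : (j : ℕ) < n + 1
  · have : (j : ℕ) = n := by omega
    rw [this, sub_self]
  · rw [hv j hjn, smul_zero, smul_zero, sub_zero]

theorem sub_apply_mem_highFlag' (h : IsTDData A A' E E' θ θ') {n : ℕ} (c : 𝕜) {v : V}
    (hv : v ∈ highFlag E (n + 1)) : A' v - c • v ∈ highFlag E n := by
  refine Submodule.sub_mem _ ?_ (Submodule.smul_mem _ _ ?_)
  · exact apply_mem_supportedOn_of_tridiagonal h.sum_eq_one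
      (fun i j hj hi => h.tridiagonal' i j (by omega)) hv
  · exact supportedOn_mono (fun j hj => by omega) hv

theorem lowFlag_zero (h : IsTDData A A' E E' θ θ') : lowFlag E' 0 = ⊥ :=
  (Submodule.eq_bot_iff _).2 fun _ hv =>
    eq_zero_of_mem_supportedOn h.sum_eq_one' (fun _ => Nat.not_lt_zero _) hv

theorem highFlag_eq_bot (h : IsTDData A A' E E' θ θ') {n : ℕ} (hn : d < n) :
    highFlag E n = ⊥ :=
  (Submodule.eq_bot_iff _).2 fun _ hv =>
    eq_zero_of_mem_supportedOn h.sum_eq_one (fun j => by omega) hv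

theorem lowFlag_eq_top {n : ℕ} (hn : d < n) : lowFlag E' n = ⊤ :=
  eq_top_iff.2 fun _ _ j hj => absurd (show (j : ℕ) < n by omega) hj

theorem highFlag_zero : highFlag E 0 = ⊤ :=
  eq_top_iff.2 fun _ _ _ hj => absurd (Nat.zero_le _) hj

/-- A family of subspaces that `A` raises and `A'` lowers, up to scalars, spans an invariant
subspace, hence by irreducibility `⊥` or `⊤`. -/
theorem iSup_eq_bot_or_eq_top (h : IsTDData A A' E E' θ θ') (W : ℕ → Submodule 𝕜 V)
    (hA : ∀ n, ∀ v ∈ W n, ∃ c : 𝕜, A v - c • v ∈ W (n + 1))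
    (hA' : ∀ n, ∀ v ∈ W n, ∃ c : 𝕜, A' v - c • v ∈ ⨆ n, W n) :
    (⨆ n, W n) = ⊥ ∨ (⨆ n, W n) = ⊤ := by
  apply h.irreducible
  · rw [Submodule.map_iSup]
    refine iSup_le fun n => ?_
    rintro _ ⟨v, hv, rfl⟩
    obtain ⟨c, hc⟩ := hA n v hv
    rw [← sub_add_cancel (A v) (c • v)]
    exact Submodule.add_mem _ (Submodule.mem_iSup_of_mem _ hc)
      (Submodule.smul_mem _ _ (Submodule.mem_iSup_of_mem n hv))
  · rw [Submodule.map_iSup]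
    refine iSup_le fun n => ?_
    rintro _ ⟨v, hv, rfl⟩
    obtain ⟨c, hc⟩ := hA' n v hv
    rw [← sub_add_cancel (A' v) (c • v)]
    exact Submodule.add_mem _ hc (Submodule.smul_mem _ _ (Submodule.mem_iSup_of_mem n hv))

theorem disjoint_flags (h : IsTDData A A' E E' θ θ') (n : ℕ) :
    Disjoint (lowFlag E' n) (highFlag E n) := by
  have key := h.iSup_eq_bot_or_eq_top (fun n => lowFlag E' n ⊓ highFlag E n)
    (fun n v hv => ⟨θ n, h.sub_apply_mem_lowFlag _ hv.1, h.sub_apply_mem_highFlag hv.2⟩)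
    (fun n v hv => by
      cases n with
      | zero =>
        have hv0 : v = 0 := by simpa [h.lowFlag_zero] using hv.1
        exact ⟨0, by simp [hv0]⟩
      | succ n =>
        exact ⟨θ' n, Submodule.mem_iSup_of_mem n
          ⟨h.sub_apply_mem_lowFlag' hv.1, h.sub_apply_mem_highFlag' _ hv.2⟩⟩)
  have hbot : (⨆ n, lowFlag E' n ⊓ highFlag E n) = ⊥ := by
    refine key.resolve_right fun htop => h.ne_zero 0 ?_
    -- every summand is annihilated by `E 0`
    have hle : (⨆ n, lowFlag E' n ⊓ highFlag E n) ≤ LinearMap.ker (E 0) := by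
      refine iSup_le fun n v hv => ?_
      cases n with
      | zero =>
        have hv0 : v = 0 := by simpa [h.lowFlag_zero] using hv.1
        simp [hv0]
      | succ n => exact hv.2 0 (by simp)
    rw [htop, top_le_iff, LinearMap.ker_eq_top] at hle
    exact hle
  rw [disjoint_iff, eq_bot_iff, ← hbot]
  exact le_iSup (fun n => lowFlag E' n ⊓ highFlag E n) n

theorem sub_apply_mem_splitComp (h : IsTDData A A' E E' θ θ') {n : ℕ} {v : V}
    (hv : v ∈ splitComp E E' n) : A v - θ n • v ∈ splitComp E E' (n + 1) :=
  ⟨h.sub_apply_mem_lowFlag _ hv.1, h.sub_apply_mem_highFlag hv.2⟩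

theorem iSup_splitComp (h : IsTDData A A' E E' θ θ') : ⨆ n, splitComp E E' n = ⊤ := by
  have key := h.iSup_eq_bot_or_eq_top (fun n => splitComp E E' n)
    (fun n v hv => ⟨θ n, h.sub_apply_mem_splitComp hv⟩)
    (fun n v hv => by
      refine ⟨θ' n, ?_⟩
      have h1 := h.sub_apply_mem_lowFlag' hv.1
      cases n with
      | zero =>
        rw [h.lowFlag_zero, Submodule.mem_bot] at h1
        rw [h1]
        exact Submodule.zero_mem _
      | succ n => exact Submodule.mem_iSup_of_mem n ⟨h1, h.sub_apply_mem_highFlag' _ hv.2⟩)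
  refine key.resolve_left fun hbot => h.ne_zero' 0 ?_
  ext v
  have hv : E' 0 v ∈ splitComp E E' 0 := by
    refine ⟨fun j hj => ?_, by rw [highFlag_zero]; trivial⟩
    have hj0 : j ≠ 0 := by rintro rfl; simp at hj
    rw [← Module.End.mul_apply, h.mul_of_ne' j 0 hj0, LinearMap.zero_apply]
  have := Submodule.mem_iSup_of_mem (p := fun n => splitComp E E' n) 0 hv
  rw [hbot, Submodule.mem_bot] at this
  exact this

theorem splitComp_eq_bot (h : IsTDData A A' E E' θ θ') {n : ℕ} (hn : d < n) :
    splitComp E E' n = ⊥ := by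
  rw [splitComp, h.highFlag_eq_bot hn, inf_bot_eq]

theorem splitComp_le_lowFlag {m n : ℕ} (hmn : m < n) : splitComp E E' m ≤ lowFlag E' n :=
  inf_le_left.trans (supportedOn_mono fun j hj => by omega)

theorem splitComp_le_highFlag {m n : ℕ} (hmn : n ≤ m) : splitComp E E' m ≤ highFlag E n :=
  inf_le_right.trans (supportedOn_mono fun j hj => by omega)

theorem isCompl_flags (h : IsTDData A A' E E' θ θ') (n : ℕ) :
    IsCompl (lowFlag E' n) (highFlag E n) := by
  refine ⟨h.disjoint_flags n, ?_⟩
  rw [codisjoint_iff, eq_top_iff, ← h.iSup_splitComp]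
  refine iSup_le fun m => ?_
  rcases lt_or_ge m n with hm | hm
  · exact (splitComp_le_lowFlag hm).trans le_sup_left
  · exact (splitComp_le_highFlag hm).trans le_sup_right

theorem lowFlag_succ (h : IsTDData A A' E E' θ θ') (n : ℕ) :
    lowFlag E' (n + 1) = lowFlag E' n ⊔ splitComp E E' n := by
  have hle : lowFlag E' n ≤ lowFlag E' (n + 1) := supportedOn_mono fun j hj => by omega
  rw [splitComp, inf_comm, ← sup_inf_assoc_of_le _ hle, (h.isCompl_flags n).sup_eq_top, top_inf_eq]

/-- A linear map can be prescribed to act by a given scalar on each component of the split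
decomposition. -/
theorem exists_end_smul_splitComp (h : IsTDData A A' E E' θ θ') (c : ℕ → 𝕜) :
    ∃ X : Module.End 𝕜 V, ∀ n, ∀ v ∈ splitComp E E' n, X v = c n • v := by
  -- `X` is constructed on one step of the flag `lowFlag E' n` after the other
  have key : ∀ N, ∃ X : Module.End 𝕜 V, ∀ n < N, ∀ v ∈ splitComp E E' n, X v = c n • v := by
    intro N
    induction N with
    | zero => exact ⟨0, fun n hn => absurd hn (Nat.not_lt_zero n)⟩
    | succ N ih =>
      obtain ⟨X, hX⟩ := ih
      let P : Module.End 𝕜 V := (highFlag E N).projection (lowFlag E' N) (h.isCompl_flags N).symm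
      have hP0 : ∀ v ∈ lowFlag E' N, P v = 0 := fun v hv =>
        (Submodule.projection_apply_eq_zero_iff _).2 hv
      have hP1 : ∀ v ∈ highFlag E N, P v = v := fun v hv =>
        Submodule.projection_apply_of_mem_left _ hv
      refine ⟨X * (1 - P) + c N • P, fun n hn v hv => ?_⟩
      rcases Nat.lt_succ_iff_lt_or_eq.1 hn with hn | rfl
      · have := hP0 v (splitComp_le_lowFlag hn hv)
        simp [this, hX n hn v hv]
      · have := hP1 v hv.2
        simp [this]
  obtain ⟨X, hX⟩ := key (d + 1)
  refine ⟨X, fun n v hv => ?_⟩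
  rcases Nat.lt_or_ge n (d + 1) with hn | hn
  · exact hX n hn v hv
  · rw [h.splitComp_eq_bot hn, Submodule.mem_bot] at hv
    simp [hv]

theorem ext_splitComp (h : IsTDData A A' E E' θ θ') {X Y : Module.End 𝕜 V}
    (hXY : ∀ n, ∀ v ∈ splitComp E E' n, X v = Y v) : X = Y := by
  rw [← sub_eq_zero, ← LinearMap.ker_eq_top, eq_top_iff, ← h.iSup_splitComp]
  refine iSup_le fun n v hv => ?_
  rw [LinearMap.mem_ker, LinearMap.sub_apply, hXY n v hv, sub_self]

theorem sub_apply_mem_lowFlag_of_smul (h : IsTDData A A' E E' θ θ') {X : Module.End 𝕜 V}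
    {c : ℕ → 𝕜} (hX : ∀ n, ∀ v ∈ splitComp E E' n, X v = c n • v) (n : ℕ) :
    ∀ v ∈ lowFlag E' (n + 1), X v - c n • v ∈ lowFlag E' n := by
  have key : ∀ n, ∀ v ∈ lowFlag E' n, X v ∈ lowFlag E' n := by
    intro n
    induction n with
    | zero =>
      intro v hv
      rw [h.lowFlag_zero, Submodule.mem_bot] at hv ⊢
      rw [hv, map_zero]
    | succ n ih =>
      intro v hv
      rw [h.lowFlag_succ] at hv ⊢
      obtain ⟨f, hf, u, hu, rfl⟩ := Submodule.mem_sup.1 hv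
      rw [map_add, hX n u hu]
      exact Submodule.add_mem_sup (ih f hf) (Submodule.smul_mem _ _ hu)
  intro v hv
  rw [h.lowFlag_succ] at hv
  obtain ⟨f, hf, u, hu, rfl⟩ := Submodule.mem_sup.1 hv
  rw [map_add, hX n u hu, smul_add, add_sub_add_right_eq_sub]
  exact Submodule.sub_mem _ (key n f hf) (Submodule.smul_mem _ _ hf)

end IsTDData

/-! ### The raising map and generation by the subspaces `K_n` -/

namespace IsTDData

variable {𝕜 V : Type*} [Field 𝕜] [AddCommGroup V] [Module 𝕜 V] {d : ℕ}
  {A A' : Module.End 𝕜 V} {E E' : Fin (d + 1) → Module.End 𝕜 V} {θ θ' : ℕ → 𝕜}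

/-- The flag `lowFlag E'` is opposite to both orderings of the `E_j V`. -/
theorem isCompl_lowFlag_lowFlag (h : IsTDData A A' E E' θ θ') {m n : ℕ} (hmn : m + n = d + 1) :
    IsCompl (lowFlag E' m) (lowFlag E n) := by
  have hr := (h.rev (η := fun i => θ (d - i))
    (fun i => by rw [Fin.val_rev]; congr 1; omega)).isCompl_flags m
  convert hr using 1
  ext v
  refine ⟨fun hv j hj => hv j.rev ?_, fun hv j hj => ?_⟩
  · change ¬ ((j.rev : Fin (d + 1)) : ℕ) < n
    change ¬ m ≤ (j : ℕ) at hj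
    rw [Fin.val_rev]; omega
  · have := hv j.rev (by
      change ¬ m ≤ ((j.rev : Fin (d + 1)) : ℕ)
      change ¬ (j : ℕ) < n at hj
      rw [Fin.val_rev]; omega)
    simpa only [Fin.rev_rev] using this

theorem finrank_lowFlag [FiniteDimensional 𝕜 V] (h : IsTDData A A' E E' θ θ') {m n : ℕ}
    (hmn : m + n = d + 1) : Module.finrank 𝕜 (lowFlag E' m) = Module.finrank 𝕜 (highFlag E n) := by
  have h1 := Submodule.finrank_add_eq_of_isCompl (h.isCompl_lowFlag_lowFlag hmn)
  have h2 := Submodule.finrank_add_eq_of_isCompl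
    (isCompl_supportedOn h.sum_eq_one h.mul_of_ne fun j => (j : ℕ) < n)
  have h3 : (supportedOn E fun j => ¬ (j : ℕ) < n) = highFlag E n := by
    simp only [not_lt]; rfl
  rw [h3] at h2
  change Module.finrank 𝕜 (lowFlag E n) + _ = _ at h2
  omega

theorem finrank_splitComp_add [FiniteDimensional 𝕜 V] (h : IsTDData A A' E E' θ θ') (n : ℕ) :
    Module.finrank 𝕜 (splitComp E E' n) + Module.finrank 𝕜 V =
      Module.finrank 𝕜 (lowFlag E' (n + 1)) + Module.finrank 𝕜 (highFlag E n) := by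
  have h1 := Submodule.finrank_sup_add_finrank_inf_eq (lowFlag E' (n + 1)) (highFlag E n)
  have h2 : lowFlag E' (n + 1) ⊔ highFlag E n = ⊤ := by
    rw [eq_top_iff, ← (h.isCompl_flags n).sup_eq_top]
    exact sup_le_sup_right (supportedOn_mono fun j hj => by omega) _
  rw [h2, finrank_top] at h1
  rw [splitComp]
  omega

/-- The dimensions of the components of the split decomposition are symmetric. -/
theorem finrank_splitComp_symm [FiniteDimensional 𝕜 V] (h : IsTDData A A' E E' θ θ') {m n : ℕ}
    (hmn : m + n = d) :
    Module.finrank 𝕜 (splitComp E E' m) = Module.finrank 𝕜 (splitComp E E' n) := by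
  have h1 := h.finrank_splitComp_add m
  have h2 := h.finrank_splitComp_add n
  have h3 := h.finrank_lowFlag (m := m + 1) (n := n) (by omega)
  have h4 := h.finrank_lowFlag (m := n + 1) (n := m) (by omega)
  omega

theorem pow_apply_mem_splitComp (h : IsTDData A A' E E' θ θ') {R : Module.End 𝕜 V}
    (hR : ∀ n, ∀ v ∈ splitComp E E' n, R v = A v - θ n • v) (k : ℕ) :
    ∀ n, ∀ v ∈ splitComp E E' n, (R ^ k) v ∈ splitComp E E' (n + k) := by
  induction k with
  | zero => intro n v hv; simpa using hv
  | succ k ih =>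
    intro n v hv
    rw [pow_succ, Module.End.mul_apply, hR n v hv, show n + (k + 1) = n + 1 + k by ring]
    exact ih _ _ (h.sub_apply_mem_splitComp hv)

/-- On `splitComp E E' n` the map `R ^ k` acts as `(A - θ (n + k - 1)) ⋯ (A - θ n)`, so its kernel
there is contained in `E_n V + ⋯ + E_{n+k-1} V`. -/
theorem mem_supportedOn_of_pow_apply_eq_zero (h : IsTDData A A' E E' θ θ')
    {R : Module.End 𝕜 V} (hR : ∀ n, ∀ v ∈ splitComp E E' n, R v = A v - θ n • v) (k : ℕ) :
    ∀ n, n + k ≤ d + 1 → ∀ v ∈ splitComp E E' n, (R ^ k) v = 0 →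
      v ∈ supportedOn E fun j => n ≤ (j : ℕ) ∧ (j : ℕ) < n + k := by
  induction k with
  | zero =>
    intro n _ v _ h0
    rw [pow_zero, Module.End.one_apply] at h0
    rw [h0]
    exact Submodule.zero_mem _
  | succ k ih =>
    intro n hn v hv h0 j hj
    rw [pow_succ, Module.End.mul_apply, hR n v hv] at h0
    have h1 := ih (n + 1) (by omega) _ (h.sub_apply_mem_splitComp hv) h0 j (by omega)
    have e : E j (A v) = θ j • E j v := LinearMap.congr_fun (h.mul_eq j) v
    rw [map_sub, map_smul, e, ← sub_smul, smul_eq_zero, sub_eq_zero] at h1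
    refine h1.resolve_left fun hθ => hj ?_
    have := congrArg Fin.val (h.theta_inj j ⟨n, by omega⟩ hθ)
    simp only at this
    omega

theorem pow_apply_injective (h : IsTDData A A' E E' θ θ')
    {R : Module.End 𝕜 V} (hR : ∀ n, ∀ v ∈ splitComp E E' n, R v = A v - θ n • v) {k n : ℕ}
    (hkn : n + k + n ≤ d) {v : V} (hv : v ∈ splitComp E E' n) (h0 : (R ^ k) v = 0) : v = 0 := by
  have h1 := h.mem_supportedOn_of_pow_apply_eq_zero hR k n (by omega) v hv h0
  have h2 : v ∈ lowFlag E (d - n) := supportedOn_mono (fun j hj => by omega) h1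
  exact (Submodule.disjoint_def.1 (h.isCompl_lowFlag_lowFlag (m := n + 1) (n := d - n)
    (by omega)).disjoint) v hv.1 h2

theorem exists_pow_apply_eq [FiniteDimensional 𝕜 V] (h : IsTDData A A' E E' θ θ')
    {R : Module.End 𝕜 V} (hR : ∀ n, ∀ v ∈ splitComp E E' n, R v = A v - θ n • v) {k n : ℕ}
    (hkn : n + k + n = d) {w : V} (hw : w ∈ splitComp E E' (n + k)) :
    ∃ v ∈ splitComp E E' n, (R ^ k) v = w := by
  have hle : (splitComp E E' n).map (R ^ k) ≤ splitComp E E' (n + k) := by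
    rintro _ ⟨v, hv, rfl⟩
    exact h.pow_apply_mem_splitComp hR k n v hv
  have heq : (splitComp E E' n).map (R ^ k) = splitComp E E' (n + k) := by
    refine Submodule.eq_of_le_of_finrank_eq hle ?_
    rw [← h.finrank_splitComp_symm (m := n) (n := n + k) (by omega)]
    have hinj' : Function.Injective ((R ^ k).domRestrict (splitComp E E' n)) := by
      rw [← LinearMap.ker_eq_bot, LinearMap.ker_eq_bot']
      intro v h0
      exact Subtype.ext (h.pow_apply_injective hR hkn.le v.2 h0)
    have := LinearMap.finrank_range_of_inj hinj'
    rwa [LinearMap.range_domRestrict] at this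
  rw [← heq] at hw
  exact hw

/-- The subspaces `K_n`, `n ≤ d / 2`, generate `V` under the raising map: for `1 ≤ n ≤ d / 2` the
component `splitComp E E' n` is the sum of `K_n` and the image of the preceding component, and for
`n > d / 2` it is an image of `splitComp E E' (d - n)`. -/
theorem eq_top_of_raising_invariant [FiniteDimensional 𝕜 V] (h : IsTDData A A' E E' θ θ')
    {R : Module.End 𝕜 V} (hR : ∀ n, ∀ v ∈ splitComp E E' n, R v = A v - θ n • v)
    (M : Submodule 𝕜 V)
    (hK : ∀ n, 2 * n ≤ d → lowFlag E' (n + 1) ⊓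
      (supportedOn E fun j => n ≤ (j : ℕ) ∧ (j : ℕ) + n ≤ d) ≤ M)
    (hM : ∀ n, ∀ v ∈ splitComp E E' n, v ∈ M → R v ∈ M) : M = ⊤ := by
  have hpow : ∀ k n, ∀ v ∈ splitComp E E' n, v ∈ M → (R ^ k) v ∈ M := by
    intro k
    induction k with
    | zero => intro n v _ hvM; simpa using hvM
    | succ k ih =>
      intro n v hv hvM
      rw [pow_succ, Module.End.mul_apply]
      refine ih (n + 1) _ ?_ (hM n v hv hvM)
      rw [hR n v hv]
      exact h.sub_apply_mem_splitComp hv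
  have hlow : ∀ n, 2 * n ≤ d → splitComp E E' n ≤ M := by
    intro n
    induction n with
    | zero =>
      intro hn v hv
      exact hK 0 hn ⟨hv.1, fun j hj => absurd (by omega) hj⟩
    | succ n ih =>
      intro hn v hv
      obtain ⟨u, hu, hue⟩ : ∃ u ∈ splitComp E E' n,
          (R ^ (d - 2 * n)) u = (R ^ (d - 2 * n - 1)) v := by
        refine h.exists_pow_apply_eq hR (by omega) ?_
        have := h.pow_apply_mem_splitComp hR (d - 2 * n - 1) (n + 1) v hv
        rwa [show n + 1 + (d - 2 * n - 1) = n + (d - 2 * n) by omega] at this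
      have hRu : R u ∈ splitComp E E' (n + 1) := by
        rw [hR n u hu]
        exact h.sub_apply_mem_splitComp hu
      have hvu : v - R u ∈ splitComp E E' (n + 1) := Submodule.sub_mem _ hv hRu
      have h0 : (R ^ (d - 2 * n - 1)) (v - R u) = 0 := by
        rw [map_sub, ← hue, show d - 2 * n = d - 2 * n - 1 + 1 by omega, pow_succ,
          Module.End.mul_apply, Nat.add_sub_cancel, sub_self]
      have h1 := h.mem_supportedOn_of_pow_apply_eq_zero hR _ _ (by omega) _ hvu h0
      rw [← sub_add_cancel v (R u)]
      refine Submodule.add_mem _ (hK (n + 1) hn ⟨hvu.1, ?_⟩) (hM n u hu (ih (by omega) hu))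
      exact supportedOn_mono (fun j hj => by omega) h1
  rw [eq_top_iff, ← h.iSup_splitComp]
  refine iSup_le fun n v hv => ?_
  by_cases hn : 2 * n ≤ d
  · exact hlow n hn hv
  · by_cases hnd : d < n
    · rw [h.splitComp_eq_bot hnd, Submodule.mem_bot] at hv
      rw [hv]
      exact M.zero_mem
    · rw [show n = d - n + (2 * n - d) by omega] at hv
      obtain ⟨u, hu, rfl⟩ := h.exists_pow_apply_eq hR (by omega) hv
      exact hpow _ _ u hu (hlow _ (by omega) hu)

end IsTDData

/-! ### Relations between `A`, `K`, `B` and `ψ` in an associative algebra -/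

section Algebra

variable {𝕜 S : Type*} [Field 𝕜] [Ring S] [Algebra 𝕜 S] {q a : 𝕜} {A K B : S}

/-- Let `Z` be the defect of the exchange relation `u C = q² C u`, where `C = K - B` and
`u = a K - a⁻¹ B`. Then `A Z - q⁴ Z A` is a combination of `Z K`, `Z B`, `K Z` and `B Z`; hence
`Z` vanishes at `A m` as soon as it vanishes at `m`, `K m` and `B m`. -/
theorem mul_exchange_defect (ha : a ≠ 0)
    (hK : A * K = q ^ 2 • (K * A) - (q ^ 2 - 1) • (a • (K * K) + a⁻¹ • (1 : S)))
    (hB : A * B = q ^ 2 • (B * A) - (q ^ 2 - 1) • (a⁻¹ • (B * B) + a • (1 : S))) {Z : S}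
    (hZ : Z = (a • K - a⁻¹ • B) * (K - B) - q ^ 2 • ((K - B) * (a • K - a⁻¹ • B))) :
    (a - a⁻¹) • (A * Z) = ((a - a⁻¹) * q ^ 4) • (Z * A) - (q ^ 2 - 1) •
      ((a * (a * q ^ 2 - a⁻¹)) • (Z * K) + (a⁻¹ * (a - a⁻¹ * q ^ 2)) • (Z * B) +
        (a * (a - a⁻¹ * q ^ 2)) • (K * Z) + (a⁻¹ * (a * q ^ 2 - a⁻¹)) • (B * Z)) := by
  have hKK : A * (K * K) = q ^ 4 • (K * (K * A)) - (q ^ 2 - 1) •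
      ((q ^ 2 + 1) • (a • (K * (K * K)) + a⁻¹ • K)) := by
    rw [← mul_assoc, hK]
    simp only [sub_mul, smul_mul_assoc, mul_assoc, hK, add_mul, mul_sub, mul_add, mul_smul_comm,
      one_mul, mul_one]
    module
  have hKB : A * (K * B) = q ^ 4 • (K * (B * A)) - (q ^ 2 - 1) •
      (q ^ 2 • (a⁻¹ • (K * (B * B)) + a • K) + (a • (K * (K * B)) + a⁻¹ • B)) := by
    rw [← mul_assoc, hK]
    simp only [sub_mul, smul_mul_assoc, mul_assoc, hB, add_mul, mul_sub, mul_add, mul_smul_comm,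
      one_mul, mul_one]
    module
  have hBK : A * (B * K) = q ^ 4 • (B * (K * A)) - (q ^ 2 - 1) •
      (q ^ 2 • (a • (B * (K * K)) + a⁻¹ • B) + (a⁻¹ • (B * (B * K)) + a • K)) := by
    rw [← mul_assoc, hB]
    simp only [sub_mul, smul_mul_assoc, mul_assoc, hK, add_mul, mul_sub, mul_add, mul_smul_comm,
      one_mul, mul_one]
    module
  have hBB : A * (B * B) = q ^ 4 • (B * (B * A)) - (q ^ 2 - 1) •
      ((q ^ 2 + 1) • (a⁻¹ • (B * (B * B)) + a • B)) := by
    rw [← mul_assoc, hB]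
    simp only [sub_mul, smul_mul_assoc, mul_assoc, hB, add_mul, mul_sub, mul_add, mul_smul_comm,
      one_mul, mul_one]
    module
  subst hZ
  simp only [sub_mul, mul_sub, smul_mul_assoc, mul_smul_comm, mul_assoc, smul_sub, hKK, hKB,
    hBK, hBB]
  match_scalars <;> field_simp <;> ring

/-- If `u = a K - a⁻¹ B` is invertible and `u C = q² C u` for `C = K - B`, the element
`ψ = q u⁻¹ C = q⁻¹ C u⁻¹` satisfies the commutation relation of the double lowering map. -/
theorem commutator_of_exchange (hq : q ≠ 0) (ha : a ≠ 0) (ha1 : a - a⁻¹ ≠ 0) {ψ Ki w : S}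
    (hK : A * K = q ^ 2 • (K * A) - (q ^ 2 - 1) • (a • (K * K) + a⁻¹ • (1 : S)))
    (hB : A * B = q ^ 2 • (B * A) - (q ^ 2 - 1) • (a⁻¹ • (B * B) + a • (1 : S)))
    (hKi : K * Ki = 1) (hKi' : Ki * K = 1) (hw : w * (a • K - a⁻¹ • B) = 1)
    (hl : (a • K - a⁻¹ • B) * ψ = q • (K - B)) (hr : ψ * (a • K - a⁻¹ • B) = q⁻¹ • (K - B)) :
    ψ * (A - a • K - a⁻¹ • Ki) - (A - a • K - a⁻¹ • Ki) * ψ = (q - q⁻¹) • (K - Ki) := by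
  -- `γ` is the coefficient of `C * C` when `u C = q² C u` is solved for `K C`, see `hKC`
  obtain ⟨γ, hγ⟩ : ∃ γ : 𝕜, γ * (a - a⁻¹) = a⁻¹ * (q ^ 2 - 1) :=
    ⟨a⁻¹ * (q ^ 2 - 1) / (a - a⁻¹), div_mul_cancel₀ _ ha1⟩
  obtain ⟨C, hC⟩ : ∃ C, C = K - B := ⟨_, rfl⟩
  obtain ⟨u, hu⟩ : ∃ u, u = a • K - a⁻¹ • B := ⟨_, rfl⟩
  rw [← hC, ← hu] at hl hr
  rw [← hu] at hw
  have hBC : B = K - C := by rw [hC]; abel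
  have huK : u = (a - a⁻¹) • K + a⁻¹ • C := by rw [hu, hBC]; module
  have hCr : C = q • (ψ * u) := by rw [hr, smul_smul, mul_inv_cancel₀ hq, one_smul]
  have huC : u * C = q ^ 2 • (C * u) := by
    rw [hCr, mul_smul_comm, ← mul_assoc, hl, ← hCr, smul_mul_assoc, smul_smul, sq]
  have hCψ : C * ψ = q ^ 2 • (ψ * C) := by
    nth_rewrite 1 [hCr]
    rw [smul_mul_assoc, mul_assoc, hl, mul_smul_comm, smul_smul, sq]
  have hKψ : K * ψ = q ^ 2 • (ψ * K) := by
    have e1 : u * ψ = q ^ 2 • (ψ * u) := by rw [hl, hr, smul_smul]; congr 1; field_simp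
    rw [huK, add_mul, mul_add, smul_mul_assoc, smul_mul_assoc, mul_smul_comm, mul_smul_comm,
      hCψ] at e1
    have e2 : (a - a⁻¹) • (K * ψ) = (a - a⁻¹) • (q ^ 2 • (ψ * K)) := by
      linear_combination (norm := module) e1
    exact smul_right_injective S ha1 e2
  have hKiψ : Ki * ψ = (q ^ 2)⁻¹ • (ψ * Ki) := by
    have e : ψ * Ki = q ^ 2 • (Ki * ψ) := by
      calc ψ * Ki = Ki * (K * ψ) * Ki := by rw [← mul_assoc, hKi', one_mul]
        _ = q ^ 2 • (Ki * ψ * (K * Ki)) := by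
          rw [hKψ]; simp only [mul_smul_comm, smul_mul_assoc, mul_assoc]
        _ = _ := by rw [hKi, mul_one]
    rw [e, smul_smul, inv_mul_cancel₀ (pow_ne_zero 2 hq), one_smul]
  have hKC : K * C = q ^ 2 • (C * K) + γ • (C * C) := by
    rw [huK] at huC
    simp only [add_mul, mul_add, smul_mul_assoc, mul_smul_comm] at huC
    apply smul_right_injective S ha1
    change (a - a⁻¹) • (K * C) = (a - a⁻¹) • (q ^ 2 • (C * K) + γ • (C * C))
    rw [smul_add, smul_smul (a - a⁻¹) γ, mul_comm _ γ, hγ]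
    linear_combination (norm := module) huC
  have hcomm : K * B - B * K = -(a * γ) • (C * u) := by
    have e : a * γ * (a - a⁻¹) = q ^ 2 - 1 := by rw [mul_assoc, hγ]; field_simp
    rw [hBC, huK]
    rw [mul_add, mul_smul_comm, mul_smul_comm, neg_smul, smul_add, smul_smul _ (a - a⁻¹), e,
      mul_sub, sub_mul, hKC]
    match_scalars <;> field_simp <;> ring
  have hY : ((a * a) • (K * K) - (a⁻¹ * a⁻¹) • (B * B)) * ψ =
      q • (a • (K * C) + a⁻¹ • (K * C) - a⁻¹ • (C * C)) - (q * (a * γ)) • (C * C) := by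
    have e : (a * a) • (K * K) - (a⁻¹ * a⁻¹) • (B * B) =
        a • (K * u) + a⁻¹ • (B * u) + (K * B - B * K) := by
      rw [hu]
      simp only [mul_sub, mul_smul_comm]
      match_scalars <;> field_simp <;> ring
    rw [e, hcomm]
    simp only [add_mul, smul_mul_assoc, mul_assoc, hl, mul_smul_comm]
    rw [hBC]
    simp only [sub_mul]
    module
  have hAu : A * u = q ^ 2 • (u * A) -
      (q ^ 2 - 1) • ((a * a) • (K * K) - (a⁻¹ * a⁻¹) • (B * B)) := by
    rw [hu, mul_sub, mul_smul_comm, mul_smul_comm, hK, hB]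
    simp only [sub_mul, smul_mul_assoc]
    match_scalars <;> field_simp
    ring
  have hAC : A * C = q ^ 2 • (C * A) -
      (q ^ 2 - 1) • (a • (K * K) - a⁻¹ • (B * B) + (a⁻¹ - a) • (1 : S)) := by
    rw [hC, mul_sub, hK, hB, sub_mul]
    module
  have huA : u * (A * ψ) = q • (C * A) - (q⁻¹ * (q ^ 2 - 1)) •
      (a • (K * K) - a⁻¹ • (B * B) + (a⁻¹ - a) • (1 : S)) + ((q ^ 2)⁻¹ * (q ^ 2 - 1)) •
      (((a * a) • (K * K) - (a⁻¹ * a⁻¹) • (B * B)) * ψ) := by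
    have e : A * u * ψ = q • (A * C) := by rw [mul_assoc, hl, mul_smul_comm]
    rw [hAu, hAC, sub_mul, smul_mul_assoc, smul_mul_assoc, mul_assoc] at e
    apply smul_right_injective S (pow_ne_zero 2 hq)
    change q ^ 2 • (u * (A * ψ)) = q ^ 2 • _
    rw [sub_eq_iff_eq_add.1 e]
    match_scalars <;> field_simp
  -- after multiplying by `u`, both sides reduce to combinations of `K K`, `C K`, `C C`, `C Ki`, `1`
  have hcancel : ∀ x y : S, u * x = u * y → x = y := fun x y e => by
    rw [← one_mul x, ← one_mul y, ← hw, mul_assoc, mul_assoc, e]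
  apply hcancel
  have huψ : ∀ x, u * (ψ * x) = q • (C * x) := fun x => by
    rw [← mul_assoc, hl, smul_mul_assoc]
  simp only [mul_sub, sub_mul, smul_mul_assoc, mul_smul_comm, hKψ, hKiψ, huψ, huA, hY]
  have e1 : u * K = (a - a⁻¹) • (K * K) + a⁻¹ • (C * K) := by
    rw [huK, add_mul, smul_mul_assoc, smul_mul_assoc]
  have e2 : u * Ki = (a - a⁻¹) • (1 : S) + a⁻¹ • (C * Ki) := by
    rw [huK, add_mul, smul_mul_assoc, smul_mul_assoc, hKi]
  rw [e1, e2, hBC]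
  simp only [mul_sub, sub_mul, hKC]
  match_scalars <;> field_simp <;> ring

end Algebra

/-! ### From standard idempotents to resolutions of the identity -/

namespace IsStandardIdempotents

variable {𝕜 V : Type*} [Field 𝕜] [AddCommGroup V] [Module 𝕜 V] {d : ℕ}
  {A A' : Module.End 𝕜 V} {E : Fin (d + 1) → Module.End 𝕜 V}

theorem mul_eq_zero (hE : IsStandardIdempotents A A' E) (i j : Fin (d + 1)) (hij : i ≠ j) :
    E i * E j = 0 :=
  LinearMap.ext fun x => hE.apply_ne i j hij.symm _ ⟨x, rfl⟩

theorem ext_range (hE : IsStandardIdempotents A A' E) (hA : IsDiagonalizableEnd A)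
    {X Y : Module.End 𝕜 V} (h : ∀ i, ∀ v ∈ LinearMap.range (E i), X v = Y v) : X = Y := by
  have htop : ⨆ i, LinearMap.range (E i) = ⊤ := by
    rw [← hA, ← sSup_range]
    exact congrArg sSup hE.standard.range_eq
  rw [← sub_eq_zero, ← LinearMap.ker_eq_top, eq_top_iff, ← htop]
  refine iSup_le fun n v hv => ?_
  rw [LinearMap.mem_ker, LinearMap.sub_apply, h n v hv, sub_self]

theorem sum_eq_one (hE : IsStandardIdempotents A A' E) (hA : IsDiagonalizableEnd A) :
    ∑ i, E i = 1 := by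
  refine hE.ext_range hA fun i v hv => ?_
  rw [LinearMap.sum_apply, Finset.sum_eq_single i, hE.apply_self i v hv, Module.End.one_apply]
  · exact fun j _ hj => hE.apply_ne j i hj.symm v hv
  · exact fun hi => absurd (Finset.mem_univ i) hi

theorem mul_eq_smul (hE : IsStandardIdempotents A A' E) (hA : IsDiagonalizableEnd A)
    {θ : Fin (d + 1) → 𝕜} (hθ : ∀ i, LinearMap.range (E i) = A.eigenspace (θ i))
    (i : Fin (d + 1)) : E i * A = θ i • E i := by
  refine hE.ext_range hA fun j v hv => ?_
  have hAv : A v = θ j • v := Module.End.mem_eigenspace_iff.1 (hθ j ▸ hv)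
  rw [Module.End.mul_apply, hAv, map_smul, LinearMap.smul_apply]
  by_cases hij : j = i
  · rw [hij]
  · rw [hE.apply_ne i j hij v hv, smul_zero, smul_zero]

theorem ne_zero (hE : IsStandardIdempotents A A' E) (i : Fin (d + 1)) : E i ≠ 0 := by
  intro h0
  have h : LinearMap.range (E i) ∈ Set.range fun i => LinearMap.range (E i) := ⟨i, rfl⟩
  rw [hE.standard.range_eq] at h
  exact h.1 (by rw [h0, LinearMap.range_zero])

theorem eigenvalue_injective (hE : IsStandardIdempotents A A' E)
    {θ : Fin (d + 1) → 𝕜} (hθ : ∀ i, LinearMap.range (E i) = A.eigenspace (θ i)) :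
    Function.Injective θ := fun i j hij =>
  hE.standard.injective (show LinearMap.range (E i) = LinearMap.range (E j) by
    rw [hθ, hθ, hij])

theorem mul_mul_eq_zero (hE : IsStandardIdempotents A A' E) (hA : IsDiagonalizableEnd A)
    (i j : Fin (d + 1)) (hij : (i : ℕ) + 1 < j ∨ (j : ℕ) + 1 < i) : E i * A' * E j = 0 := by
  ext x
  have h := hE.standard.tridiagonal j ⟨E j x, ⟨x, rfl⟩, rfl⟩
  rw [iSup_range_eq_supportedOn (hE.sum_eq_one hA) hE.mul_eq_zero] at h
  exact h i (by omega)

end IsStandardIdempotents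

/-! ### The operators `K` and `B` for eigenvalues of `q`-Racah type -/

/-- The eigenvalue `a q^{d-2n} + a⁻¹ q^{2n-d}` of `q`-Racah type. -/
noncomputable def racahEigenvalue {𝕜 : Type*} [Field 𝕜] (q a : 𝕜) (d n : ℕ) : 𝕜 :=
  a * q ^ ((d : ℤ) - 2 * (n : ℤ)) + a⁻¹ * q ^ (2 * (n : ℤ) - (d : ℤ))

namespace IsTDData

variable {𝕜 V : Type*} [Field 𝕜] [AddCommGroup V] [Module 𝕜 V] {d : ℕ}
  {A A' : Module.End 𝕜 V} {E E' : Fin (d + 1) → Module.End 𝕜 V} {θ' : ℕ → 𝕜} {q a : 𝕜}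

theorem rev_racah (h : IsTDData A A' E E' (racahEigenvalue q a d) θ') :
    IsTDData A A' (fun i => E i.rev) E' (racahEigenvalue q a⁻¹ d) θ' := by
  refine h.rev fun i => ?_
  have hi : (((i.rev : Fin (d + 1)) : ℕ) : ℤ) = d - i := by rw [Fin.val_rev]; omega
  rw [racahEigenvalue, racahEigenvalue, hi, inv_inv, add_comm]
  congr 3 <;> ring

/-- An operator acting as `q^{d-2n}` on the `n`-th component of the split decomposition satisfies
a `q`-Weyl type relation with `A`, because `A - a X - a⁻¹ X⁻¹` raises the components. -/
theorem mul_eq_of_smul (h : IsTDData A A' E E' (racahEigenvalue q a d) θ') (hq : q ≠ 0)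
    {X : Module.End 𝕜 V}
    (hX : ∀ n, ∀ v ∈ splitComp E E' n, X v = q ^ ((d : ℤ) - 2 * (n : ℤ)) • v) :
    A * X = q ^ 2 • (X * A) - (q ^ 2 - 1) • (a • (X * X) + a⁻¹ • (1 : Module.End 𝕜 V)) := by
  refine h.ext_splitComp fun n v hv => ?_
  have hu := h.sub_apply_mem_splitComp hv
  obtain ⟨u, hue⟩ : ∃ u, u = A v - racahEigenvalue q a d n • v := ⟨_, rfl⟩
  rw [← hue] at hu
  have hAv : A v = u + racahEigenvalue q a d n • v := by rw [hue, sub_add_cancel]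
  have hXu := hX _ u hu
  rw [show (d : ℤ) - 2 * ((n + 1 : ℕ) : ℤ) = (d - 2 * n) - 2 by push_cast; ring,
    zpow_sub₀ hq] at hXu
  have hk : q ^ (2 * (n : ℤ) - (d : ℤ)) = (q ^ ((d : ℤ) - 2 * (n : ℤ)))⁻¹ := by
    rw [← zpow_neg]; congr 1; ring
  have hk0 : q ^ ((d : ℤ) - 2 * (n : ℤ)) ≠ 0 := zpow_ne_zero _ hq
  have hXv := hX n v hv
  rw [racahEigenvalue, hk] at hAv
  generalize q ^ ((d : ℤ) - 2 * (n : ℤ)) = k at *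
  simp only [Module.End.mul_apply, LinearMap.sub_apply, LinearMap.smul_apply, LinearMap.add_apply,
    Module.End.one_apply, hXv, hXu, hAv, map_smul, map_add]
  match_scalars
  · field_simp
  · field_simp
    ring

theorem isUnit_of_smul (h : IsTDData A A' E E' (racahEigenvalue q a d) θ') (hq : q ≠ 0)
    {X : Module.End 𝕜 V}
    (hX : ∀ n, ∀ v ∈ splitComp E E' n, X v = q ^ ((d : ℤ) - 2 * (n : ℤ)) • v) : IsUnit X := by
  obtain ⟨Y, hY⟩ := h.exists_end_smul_splitComp fun n => (q ^ ((d : ℤ) - 2 * (n : ℤ)))⁻¹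
  have hk (n : ℕ) : q ^ ((d : ℤ) - 2 * (n : ℤ)) ≠ 0 := zpow_ne_zero _ hq
  refine ⟨⟨X, Y, h.ext_splitComp fun n v hv => ?_, h.ext_splitComp fun n v hv => ?_⟩, rfl⟩
  · rw [Module.End.mul_apply, hY n v hv, map_smul, hX n v hv, smul_smul, inv_mul_cancel₀ (hk n),
      one_smul, Module.End.one_apply]
  · rw [Module.End.mul_apply, hX n v hv, map_smul, hY n v hv, smul_smul, mul_inv_cancel₀ (hk n),
      one_smul, Module.End.one_apply]

/-- A map that is triangular on the flag `lowFlag E'` with nonzero diagonal is invertible. -/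
theorem isUnit_of_triangular [FiniteDimensional 𝕜 V] {θ : ℕ → 𝕜} (h : IsTDData A A' E E' θ θ')
    {X : Module.End 𝕜 V} {c : ℕ → 𝕜} (hc : ∀ n, c n ≠ 0)
    (hX : ∀ n, ∀ v ∈ lowFlag E' (n + 1), X v - c n • v ∈ lowFlag E' n) : IsUnit X := by
  rw [LinearMap.isUnit_iff_ker_eq_bot, LinearMap.ker_eq_bot']
  intro v hv
  have key : ∀ n, v ∈ lowFlag E' n → v = 0 := by
    intro n
    induction n with
    | zero => intro hn; rwa [h.lowFlag_zero, Submodule.mem_bot] at hn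
    | succ n ih =>
      intro hn
      have := hX n v hn
      rw [hv, zero_sub, neg_mem_iff] at this
      exact ih ((Submodule.smul_mem_iff _ (hc n)).1 this)
  exact key (d + 1) (by rw [lowFlag_eq_top (Nat.lt_succ_self d)]; trivial)

theorem isUnit_smul_sub_smul [FiniteDimensional 𝕜 V]
    (h : IsTDData A A' E E' (racahEigenvalue q a d) θ') (hq : q ≠ 0) (ha1 : a - a⁻¹ ≠ 0)
    {K B : Module.End 𝕜 V}
    (hK : ∀ n, ∀ v ∈ splitComp E E' n, K v = q ^ ((d : ℤ) - 2 * (n : ℤ)) • v)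
    (hB : ∀ n, ∀ v ∈ splitComp (fun i => E i.rev) E' n, B v = q ^ ((d : ℤ) - 2 * (n : ℤ)) • v) :
    IsUnit (a • K - a⁻¹ • B) := by
  refine h.isUnit_of_triangular (c := fun n => (a - a⁻¹) * q ^ ((d : ℤ) - 2 * (n : ℤ)))
    (fun n => mul_ne_zero ha1 (zpow_ne_zero _ hq)) fun n v hv => ?_
  have h1 := h.sub_apply_mem_lowFlag_of_smul (c := fun n => q ^ ((d : ℤ) - 2 * (n : ℤ))) hK n v hv
  have h2 := h.rev_racah.sub_apply_mem_lowFlag_of_smul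
    (c := fun n => q ^ ((d : ℤ) - 2 * (n : ℤ))) hB n v hv
  convert Submodule.sub_mem _ (Submodule.smul_mem _ a h1) (Submodule.smul_mem _ a⁻¹ h2) using 1
  simp only [LinearMap.sub_apply, LinearMap.smul_apply]
  module

theorem mem_splitComp_of_mem {n : ℕ} {v : V} (hv : v ∈ lowFlag E' (n + 1) ⊓
      (supportedOn E fun j => n ≤ (j : ℕ) ∧ (j : ℕ) + n ≤ d)) :
    v ∈ splitComp E E' n ∧ v ∈ splitComp (fun i => E i.rev) E' n := by
  refine ⟨⟨hv.1, supportedOn_mono (fun j hj => hj.1) hv.2⟩, hv.1, fun j hj => hv.2 j.rev ?_⟩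
  change ¬ n ≤ (j : ℕ) at hj
  change ¬ (n ≤ ((j.rev : Fin (d + 1)) : ℕ) ∧ ((j.rev : Fin (d + 1)) : ℕ) + n ≤ d)
  rw [Fin.val_rev]
  omega

theorem map_sup_map_le {X : Module.End 𝕜 V} {b c : 𝕜} (hq : q ≠ 0)
    (hAX : A * X = q ^ 2 • (X * A) - (q ^ 2 - 1) • (b • (X * X) + c • (1 : Module.End 𝕜 V)))
    {M : Submodule 𝕜 V} (hM : M.map X ≤ M) : (M ⊔ M.map A).map X ≤ M ⊔ M.map A := by
  rw [Submodule.map_sup]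
  refine sup_le (hM.trans le_sup_left) ?_
  rintro _ ⟨_, ⟨m, hm, rfl⟩, rfl⟩
  have hXm : X m ∈ M := hM ⟨m, hm, rfl⟩
  have hXXm : X (X m) ∈ M := hM ⟨_, hXm, rfl⟩
  have e := LinearMap.congr_fun hAX m
  simp only [Module.End.mul_apply, LinearMap.sub_apply, LinearMap.smul_apply,
    LinearMap.add_apply, Module.End.one_apply] at e
  refine (Submodule.smul_mem_iff _ (pow_ne_zero 2 hq)).1 (?_ : q ^ 2 • X (A m) ∈ _)
  rw [sub_eq_iff_eq_add.1 e.symm]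
  exact Submodule.add_mem _ (Submodule.mem_sup_right ⟨_, hXm, rfl⟩)
    (Submodule.mem_sup_left (Submodule.smul_mem _ _ (Submodule.add_mem _
      (Submodule.smul_mem _ _ hXXm) (Submodule.smul_mem _ _ hm))))

/-- The quadratic relation between `K` and `B`. The largest subspace of the kernel of its defect
that is invariant under `K` and `B` is also invariant under `A`, and contains every `K_n` because
`K` and `B` act there by the same scalar; so it is everything. -/
theorem exchange [FiniteDimensional 𝕜 V]
    (h : IsTDData A A' E E' (racahEigenvalue q a d) θ') (hq : q ≠ 0) (ha : a ≠ 0)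
    (ha1 : a - a⁻¹ ≠ 0) {K B : Module.End 𝕜 V}
    (hK : ∀ n, ∀ v ∈ splitComp E E' n, K v = q ^ ((d : ℤ) - 2 * (n : ℤ)) • v)
    (hB : ∀ n, ∀ v ∈ splitComp (fun i => E i.rev) E' n, B v = q ^ ((d : ℤ) - 2 * (n : ℤ)) • v) :
    (a • K - a⁻¹ • B) * (K - B) = q ^ 2 • ((K - B) * (a • K - a⁻¹ • B)) := by
  have hAK := h.mul_eq_of_smul hq hK
  have hAB := h.rev_racah.mul_eq_of_smul hq hB
  rw [inv_inv] at hAB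
  obtain ⟨Z, hZ⟩ : ∃ Z, Z = (a • K - a⁻¹ • B) * (K - B) -
    q ^ 2 • ((K - B) * (a • K - a⁻¹ • B)) := ⟨_, rfl⟩
  have hAZ := mul_exchange_defect ha hAK hAB hZ
  rw [← sub_eq_zero, ← hZ, ← LinearMap.ker_eq_top, eq_top_iff]
  let 𝒩 : Set (Submodule 𝕜 V) := {N | N ≤ LinearMap.ker Z ∧ N.map K ≤ N ∧ N.map B ≤ N}
  obtain ⟨hMZ, hMK, hMB⟩ : sSup 𝒩 ∈ 𝒩 := by
    refine ⟨sSup_le fun N hN => hN.1, ?_, ?_⟩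
    · exact Submodule.map_le_iff_le_comap.2 (sSup_le fun N hN =>
        Submodule.map_le_iff_le_comap.1 (hN.2.1.trans (le_sSup hN)))
    · exact Submodule.map_le_iff_le_comap.2 (sSup_le fun N hN =>
        Submodule.map_le_iff_le_comap.1 (hN.2.2.trans (le_sSup hN)))
  have hMA : (sSup 𝒩).map A ≤ sSup 𝒩 := by
    refine le_trans le_sup_right (le_sSup (a := sSup 𝒩 ⊔ (sSup 𝒩).map A)
      ⟨?_, map_sup_map_le hq hAK hMK, map_sup_map_le hq hAB hMB⟩)
    · refine sup_le hMZ ?_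
      rintro _ ⟨m, hm, rfl⟩
      have hZm : Z m = 0 := hMZ hm
      have hZK : Z (K m) = 0 := hMZ (hMK ⟨m, hm, rfl⟩)
      have hZB : Z (B m) = 0 := hMZ (hMB ⟨m, hm, rfl⟩)
      have e := LinearMap.congr_fun hAZ m
      simp only [Module.End.mul_apply, LinearMap.sub_apply, LinearMap.smul_apply,
        LinearMap.add_apply, hZm, hZK, hZB, map_zero, smul_zero, add_zero, sub_zero] at e
      exact (smul_eq_zero.1 e.symm).resolve_left (mul_ne_zero ha1 (pow_ne_zero 4 hq))
  obtain ⟨Θ, hΘ⟩ := h.exists_end_smul_splitComp (racahEigenvalue q a d)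
  have hR : ∀ n, ∀ v ∈ splitComp E E' n, (A - Θ) v = A v - racahEigenvalue q a d n • v :=
    fun n v hv => by rw [LinearMap.sub_apply, hΘ n v hv]
  rw [← h.eq_top_of_raising_invariant hR (sSup 𝒩) (fun n hn => ?_) (fun n v hv hvM => ?_)]
  · exact hMZ
  · have hKv := fun v hv => hK n v (mem_splitComp_of_mem (E := E) (E' := E') hv).1
    have hBv := fun v hv => hB n v (mem_splitComp_of_mem (E := E) (E' := E') hv).2
    refine le_sSup ⟨fun v hv => ?_, ?_, ?_⟩
    · rw [LinearMap.mem_ker, hZ]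
      simp only [Module.End.mul_apply, LinearMap.sub_apply, LinearMap.smul_apply, map_sub, map_smul,
        hKv v hv, hBv v hv]
      module
    · rintro _ ⟨v, hv, rfl⟩
      rw [hKv v hv]
      exact Submodule.smul_mem _ _ hv
    · rintro _ ⟨v, hv, rfl⟩
      rw [hBv v hv]
      exact Submodule.smul_mem _ _ hv
  · rw [hR n v hv]
    exact Submodule.sub_mem _ (hMA ⟨v, hvM, rfl⟩) (Submodule.smul_mem _ _ hvM)

end IsTDData

/-! ### Fractions in a noncommutative ring -/

theorem IsFraction.of_mul_right {S : Type*} [Ring S] {x N D : S} (hD : IsUnit D) (h : x * D = N)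
    (hND : Commute N D) : IsFraction x N D where
  isUnit := hD
  eq_mul_inverse := by rw [← h, mul_assoc, Ring.mul_inverse_cancel _ hD, mul_one]
  eq_inverse_mul := by
    have e : D * x = x * D := by
      rw [h]
      refine hD.mul_right_cancel ?_
      rw [mul_assoc, h, hND.eq]
    rw [← h, ← e, ← mul_assoc, Ring.inverse_mul_cancel _ hD, one_mul]

theorem IsFraction.of_mul_left {S : Type*} [Ring S] {x N D : S} (hD : IsUnit D) (h : D * x = N)
    (hND : Commute N D) : IsFraction x N D := by
  refine .of_mul_right hD ?_ hND
  refine hD.mul_left_cancel ?_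
  rw [← mul_assoc, h, hND.eq]

theorem commute_one_sub_smul_sub {𝕜 S : Type*} [Field 𝕜] [Ring S] [Algebra 𝕜 S] (a b : 𝕜) (x : S) :
    Commute (1 - x) (a • (1 : S) - b • x) := by
  have h : Commute (1 - x) x := (Commute.one_left x).sub_left (Commute.refl x)
  exact ((Commute.one_right _).smul_right a).sub_right (h.smul_right b)

theorem IsUnit.smul_of_ne_zero {𝕜 S : Type*} [Field 𝕜] [Ring S] [Algebra 𝕜 S] {c : 𝕜} (hc : c ≠ 0)
    {x : S} (hx : IsUnit x) : IsUnit (c • x) := by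
  rw [Algebra.smul_def]
  exact ((IsUnit.mk0 c hc).map (algebraMap 𝕜 S)).mul hx

theorem isFraction_mul_inverse {𝕜 S : Type*} [Field 𝕜] [Ring S] [Algebra 𝕜 S] {q a c : 𝕜}
    {K B ψ : S} (hq : q ≠ 0) (hK : IsUnit K) (hu : IsUnit (a • K - c • B))
    (hr : ψ * (a • K - c • B) = q⁻¹ • (K - B)) :
    IsFraction ψ (1 - B * Ring.inverse K) (q • (a • (1 : S) - c • (B * Ring.inverse K))) := by
  have e : a • (1 : S) - c • (B * Ring.inverse K) = (a • K - c • B) * Ring.inverse K := by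
    rw [sub_mul, smul_mul_assoc, smul_mul_assoc, Ring.mul_inverse_cancel _ hK]
  refine .of_mul_right ?_ ?_ ((commute_one_sub_smul_sub _ _ _).smul_right _)
  · rw [e]
    exact (hu.mul hK.ringInverse).smul_of_ne_zero hq
  · rw [e, mul_smul_comm, ← mul_assoc, hr, smul_mul_assoc, smul_smul, mul_inv_cancel₀ hq, one_smul,
      sub_mul, Ring.mul_inverse_cancel _ hK]

theorem isFraction_inverse_mul {𝕜 S : Type*} [Field 𝕜] [Ring S] [Algebra 𝕜 S] {q a c : 𝕜}
    {K B ψ : S} (hK : IsUnit K) (hu : IsUnit (a • K - c • B))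
    (hl : (a • K - c • B) * ψ = q • (K - B)) :
    IsFraction ψ (q • (1 - Ring.inverse K * B)) (a • (1 : S) - c • (Ring.inverse K * B)) := by
  have e : a • (1 : S) - c • (Ring.inverse K * B) = Ring.inverse K * (a • K - c • B) := by
    rw [mul_sub, mul_smul_comm, mul_smul_comm, Ring.inverse_mul_cancel _ hK]
  refine .of_mul_left ?_ ?_ ((commute_one_sub_smul_sub _ _ _).smul_left _)
  · rw [e]
    exact hK.ringInverse.mul hu
  · rw [e, mul_assoc, hl, mul_smul_comm, mul_sub, Ring.inverse_mul_cancel _ hK]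

/-! ### Tridiagonal systems of `q`-Racah type -/

namespace TDSystem

variable {𝕜 V : Type*} [Field 𝕜] [AddCommGroup V] [Module 𝕜 V] {d : ℕ}

theorem isTDData (Φ : TDSystem 𝕜 V d) {q a b : 𝕜} (hΦ : Φ.IsQRacah q a b) :
    IsTDData Φ.A Φ.A' Φ.E Φ.E' (racahEigenvalue q a d) (racahEigenvalue q b d) := by
  have hA := Φ.isTDPair.diagonalizable
  have hA' := Φ.isTDPair.diagonalizable'
  exact
    { sum_eq_one := Φ.idempotents.sum_eq_one hA
      sum_eq_one' := Φ.idempotents'.sum_eq_one hA'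
      mul_of_ne := Φ.idempotents.mul_eq_zero
      mul_of_ne' := Φ.idempotents'.mul_eq_zero
      mul_eq := fun i => by
        rw [racahEigenvalue, ← hΦ.theta_eq]
        exact Φ.idempotents.mul_eq_smul hA Φ.range_eq_eigenspace i
      mul_eq' := fun i => by
        rw [racahEigenvalue, ← hΦ.theta'_eq]
        exact Φ.idempotents'.mul_eq_smul hA' Φ.range_eq_eigenspace' i
      ne_zero := Φ.idempotents.ne_zero
      ne_zero' := Φ.idempotents'.ne_zero
      theta_inj := fun i j hij => by
        rw [racahEigenvalue, racahEigenvalue, ← hΦ.theta_eq, ← hΦ.theta_eq] at hij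
        exact Φ.idempotents.eigenvalue_injective Φ.range_eq_eigenspace hij
      tridiagonal := Φ.idempotents'.mul_mul_eq_zero hA'
      tridiagonal' := Φ.idempotents.mul_mul_eq_zero hA
      irreducible := Φ.isTDPair.irreducible }

/-- The parameter `a` is not `±1`: otherwise `θ_0 = θ_d`. -/
theorem IsQRacah.sub_inv_ne_zero {Φ : TDSystem 𝕜 V d} {q a b : 𝕜} (hΦ : Φ.IsQRacah q a b)
    (hd : 1 ≤ d) : a - a⁻¹ ≠ 0 := by
  intro h0
  have h1 : a⁻¹ = a := (sub_eq_zero.1 h0).symm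
  have := (Φ.isTDData hΦ).theta_inj 0 (Fin.last d) (by
    rw [racahEigenvalue, racahEigenvalue, h1, add_comm, Fin.val_zero, Fin.val_last]
    congr 3 <;> push_cast <;> ring)
  have := congrArg Fin.val this
  simp only [Fin.val_zero, Fin.val_last] at this
  omega

theorem U_eq_splitComp (Φ : TDSystem 𝕜 V d) (i : Fin (d + 1)) :
    Φ.U i = splitComp Φ.E Φ.E' i := by
  rw [U, iSup_range_eq_supportedOn (Φ.idempotents'.sum_eq_one Φ.isTDPair.diagonalizable')
    Φ.idempotents'.mul_eq_zero, iSup_range_eq_supportedOn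
    (Φ.idempotents.sum_eq_one Φ.isTDPair.diagonalizable) Φ.idempotents.mul_eq_zero]
  exact congrArg₂ _ (le_antisymm (supportedOn_mono fun j hj => Nat.lt_succ_of_le hj)
    (supportedOn_mono fun j hj => Nat.le_of_lt_succ hj)) rfl

theorem Udd_eq_splitComp (Φ : TDSystem 𝕜 V d) (i : Fin (d + 1)) :
    Φ.Udd i = splitComp (fun j => Φ.E j.rev) Φ.E' i := by
  rw [Udd, iSup_range_eq_supportedOn (Φ.idempotents'.sum_eq_one Φ.isTDPair.diagonalizable')
    Φ.idempotents'.mul_eq_zero, iSup_range_eq_supportedOn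
    (Φ.idempotents.sum_eq_one Φ.isTDPair.diagonalizable) Φ.idempotents.mul_eq_zero]
  refine congrArg₂ _ (le_antisymm (supportedOn_mono fun j hj => Nat.lt_succ_of_le hj)
    (supportedOn_mono fun j hj => Nat.le_of_lt_succ hj)) ?_
  ext v
  refine ⟨fun hv j hj => hv j.rev ?_, fun hv j hj => ?_⟩
  · change ¬ (i : ℕ) ≤ j at hj
    change ¬ ((j.rev : Fin (d + 1)) : ℕ) + i ≤ d
    rw [Fin.val_rev]
    omega
  · have := hv j.rev (by
      change ¬ (j : ℕ) + i ≤ d at hj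
      change ¬ (i : ℕ) ≤ ((j.rev : Fin (d + 1)) : ℕ)
      rw [Fin.val_rev]
      omega)
    simpa only [Fin.rev_rev] using this

theorem Ksub_eq (Φ : TDSystem 𝕜 V d) (n : ℕ) : Φ.Ksub n = lowFlag Φ.E' (n + 1) ⊓
    supportedOn Φ.E fun j => n ≤ (j : ℕ) ∧ (j : ℕ) + n ≤ d := by
  rw [Ksub, iSup_range_eq_supportedOn (Φ.idempotents'.sum_eq_one Φ.isTDPair.diagonalizable')
    Φ.idempotents'.mul_eq_zero, iSup_range_eq_supportedOn
    (Φ.idempotents.sum_eq_one Φ.isTDPair.diagonalizable) Φ.idempotents.mul_eq_zero]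
  exact congrArg₂ _ (le_antisymm (supportedOn_mono fun j hj => Nat.lt_succ_of_le hj)
    (supportedOn_mono fun j hj => Nat.le_of_lt_succ hj)) rfl

theorem isK_iff {Φ : TDSystem 𝕜 V d} {q a b : 𝕜} (hΦ : Φ.IsQRacah q a b) {X : Module.End 𝕜 V} :
    Φ.IsK q X ↔
      ∀ n, ∀ v ∈ splitComp Φ.E Φ.E' n, X v = q ^ ((d : ℤ) - 2 * (n : ℤ)) • v := by
  refine ⟨fun hX n v hv => ?_, fun hX i v hv => hX i v (Φ.U_eq_splitComp i ▸ hv)⟩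
  rcases Nat.lt_or_ge d n with hn | hn
  · rw [(Φ.isTDData hΦ).splitComp_eq_bot hn, Submodule.mem_bot] at hv
    rw [hv, map_zero, smul_zero]
  · refine hX ⟨n, Nat.lt_succ_of_le hn⟩ v ?_
    rwa [U_eq_splitComp]

theorem isB_iff {Φ : TDSystem 𝕜 V d} {q a b : 𝕜} (hΦ : Φ.IsQRacah q a b) {X : Module.End 𝕜 V} :
    Φ.IsB q X ↔ ∀ n, ∀ v ∈ splitComp (fun j => Φ.E j.rev) Φ.E' n,
      X v = q ^ ((d : ℤ) - 2 * (n : ℤ)) • v := by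
  refine ⟨fun hX n v hv => ?_, fun hX i v hv => hX i v (Φ.Udd_eq_splitComp i ▸ hv)⟩
  rcases Nat.lt_or_ge d n with hn | hn
  · rw [(Φ.isTDData hΦ).rev_racah.splitComp_eq_bot hn, Submodule.mem_bot] at hv
    rw [hv, map_zero, smul_zero]
  · refine hX ⟨n, Nat.lt_succ_of_le hn⟩ v ?_
    rwa [Udd_eq_splitComp]

theorem existsUnique_isK {Φ : TDSystem 𝕜 V d} {q a b : 𝕜} (hΦ : Φ.IsQRacah q a b) :
    ∃! X, Φ.IsK q X := by
  simp only [isK_iff hΦ]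
  obtain ⟨X, hX⟩ := (Φ.isTDData hΦ).exists_end_smul_splitComp
    fun n => q ^ ((d : ℤ) - 2 * (n : ℤ))
  exact ⟨X, hX, fun Y hY => (Φ.isTDData hΦ).ext_splitComp fun n v hv => by
    rw [hX n v hv, hY n v hv]⟩

theorem existsUnique_isB {Φ : TDSystem 𝕜 V d} {q a b : 𝕜} (hΦ : Φ.IsQRacah q a b) :
    ∃! X, Φ.IsB q X := by
  simp only [isB_iff hΦ]
  obtain ⟨X, hX⟩ := (Φ.isTDData hΦ).rev_racah.exists_end_smul_splitComp
    fun n => q ^ ((d : ℤ) - 2 * (n : ℤ))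
  exact ⟨X, hX, fun Y hY => (Φ.isTDData hΦ).rev_racah.ext_splitComp fun n v hv => by
    rw [hX n v hv, hY n v hv]⟩

theorem isK_K {Φ : TDSystem 𝕜 V d} {q a b : 𝕜} (hΦ : Φ.IsQRacah q a b) : Φ.IsK q (Φ.K q) :=
  Classical.epsilon_spec (existsUnique_isK hΦ).exists

theorem isB_B {Φ : TDSystem 𝕜 V d} {q a b : 𝕜} (hΦ : Φ.IsQRacah q a b) : Φ.IsB q (Φ.B q) :=
  Classical.epsilon_spec (existsUnique_isB hΦ).exists

theorem isUnit_K {Φ : TDSystem 𝕜 V d} {q a b : 𝕜} (hΦ : Φ.IsQRacah q a b) : IsUnit (Φ.K q) :=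
  (Φ.isTDData hΦ).isUnit_of_smul hΦ.q_ne_zero ((isK_iff hΦ).1 (isK_K hΦ))

theorem isUnit_B {Φ : TDSystem 𝕜 V d} {q a b : 𝕜} (hΦ : Φ.IsQRacah q a b) : IsUnit (Φ.B q) :=
  (Φ.isTDData hΦ).rev_racah.isUnit_of_smul hΦ.q_ne_zero ((isB_iff hΦ).1 (isB_B hΦ))

/-- `R` acts on `U_n` as `A - θ_n`. -/
theorem R_apply {Φ : TDSystem 𝕜 V d} {q a b : 𝕜} (hΦ : Φ.IsQRacah q a b) (n : ℕ) (v : V)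
    (hv : v ∈ splitComp Φ.E Φ.E' n) : Φ.R q a v = Φ.A v - racahEigenvalue q a d n • v := by
  have hKv := (isK_iff hΦ).1 (isK_K hΦ) n v hv
  have hk0 : q ^ ((d : ℤ) - 2 * (n : ℤ)) ≠ 0 := zpow_ne_zero _ hΦ.q_ne_zero
  have hKi : Ring.inverse (Φ.K q) v = q ^ (2 * (n : ℤ) - (d : ℤ)) • v := by
    have e := LinearMap.congr_fun (Ring.inverse_mul_cancel _ (isUnit_K hΦ)) v
    rw [Module.End.mul_apply, hKv, map_smul, Module.End.one_apply] at e
    rw [← neg_sub, zpow_neg, eq_inv_smul_iff₀ hk0, e]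
  rw [R, LinearMap.sub_apply, LinearMap.sub_apply, LinearMap.smul_apply, LinearMap.smul_apply,
    hKv, hKi, racahEigenvalue]
  module

/-- Two maps with the defining property of `ψ` agree: their difference commutes with `R` and
vanishes on the subspaces `K_n`, which generate `V` under `R`. -/
theorem IsPsi.unique [FiniteDimensional 𝕜 V] {Φ : TDSystem 𝕜 V d} {q a b : 𝕜}
    (hΦ : Φ.IsQRacah q a b) {X Y : Module.End 𝕜 V} (hX : Φ.IsPsi q a X) (hY : Φ.IsPsi q a Y) :
    X = Y := by
  rw [← sub_eq_zero, ← LinearMap.ker_eq_top]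
  refine (Φ.isTDData hΦ).eq_top_of_raising_invariant (R_apply hΦ) _ (fun n hn v hv => ?_)
    fun n v _ hv => ?_
  · rw [← Ksub_eq] at hv
    rw [LinearMap.mem_ker, LinearMap.sub_apply, hX.2 n hn v hv, hY.2 n hn v hv, sub_self]
  · have hXY : X v = Y v := sub_eq_zero.1 hv
    have e := LinearMap.congr_fun (hX.1.trans hY.1.symm) v
    simp only [LinearMap.sub_apply, Module.End.mul_apply, hXY, sub_left_inj] at e
    rw [LinearMap.mem_ker, LinearMap.sub_apply, e, sub_self]

end TDSystem

theorem theorem9p8 {𝕜 V : Type*} [Field 𝕜] [IsAlgClosed 𝕜] [AddCommGroup V] [Module 𝕜 V]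
    [FiniteDimensional 𝕜 V] [Nontrivial V] {d : ℕ} (hd : 1 ≤ d)
    (Φ : TDSystem 𝕜 V d) (q a b : 𝕜) (hΦ : Φ.IsQRacah q a b) :
    -- the maps `K`, `B`, `ψ` are well defined, and `K`, `B` are invertible
    ((∃! X, Φ.IsK q X) ∧ Φ.IsK q (Φ.K q) ∧ IsUnit (Φ.K q)) ∧
    ((∃! X, Φ.IsB q X) ∧ Φ.IsB q (Φ.B q) ∧ IsUnit (Φ.B q)) ∧
    ((∃! X, Φ.IsPsi q a X) ∧ Φ.IsPsi q a (Φ.psi q a)) ∧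
    -- the four expressions for `ψ`
    IsFraction (Φ.psi q a)
      ((1 : Module.End 𝕜 V) - Φ.B q * Ring.inverse (Φ.K q))
      (q • (a • (1 : Module.End 𝕜 V) - a⁻¹ • (Φ.B q * Ring.inverse (Φ.K q)))) ∧
    IsFraction (Φ.psi q a)
      ((1 : Module.End 𝕜 V) - Φ.K q * Ring.inverse (Φ.B q))
      (q • (a⁻¹ • (1 : Module.End 𝕜 V) - a • (Φ.K q * Ring.inverse (Φ.B q)))) ∧
    IsFraction (Φ.psi q a)
      (q • ((1 : Module.End 𝕜 V) - Ring.inverse (Φ.K q) * Φ.B q))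
      (a • (1 : Module.End 𝕜 V) - a⁻¹ • (Ring.inverse (Φ.K q) * Φ.B q)) ∧
    IsFraction (Φ.psi q a)
      (q • ((1 : Module.End 𝕜 V) - Ring.inverse (Φ.B q) * Φ.K q))
      (a⁻¹ • (1 : Module.End 𝕜 V) - a • (Ring.inverse (Φ.B q) * Φ.K q)) := by
  have h := Φ.isTDData hΦ
  have hq := hΦ.q_ne_zero
  have ha := hΦ.a_ne_zero
  have ha1 := hΦ.sub_inv_ne_zero hd
  have hK := (TDSystem.isK_iff hΦ).1 (TDSystem.isK_K hΦ)
  have hB := (TDSystem.isB_iff hΦ).1 (TDSystem.isB_B hΦ)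
  have hKu := TDSystem.isUnit_K hΦ
  have hBu := TDSystem.isUnit_B hΦ
  have hu := h.isUnit_smul_sub_smul hq ha1 hK hB
  have hex := h.exchange hq ha ha1 hK hB
  have hAK := h.mul_eq_of_smul hq hK
  have hAB := h.rev_racah.mul_eq_of_smul hq hB
  rw [inv_inv] at hAB
  have hex_psi : ∃ ψ, Φ.IsPsi q a ψ ∧
      (a • Φ.K q - a⁻¹ • Φ.B q) * ψ = q • (Φ.K q - Φ.B q) ∧
      ψ * (a • Φ.K q - a⁻¹ • Φ.B q) = q⁻¹ • (Φ.K q - Φ.B q) := by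
    have hl : (a • Φ.K q - a⁻¹ • Φ.B q) *
        (q • (Ring.inverse (a • Φ.K q - a⁻¹ • Φ.B q) * (Φ.K q - Φ.B q))) =
        q • (Φ.K q - Φ.B q) := by
      rw [mul_smul_comm, ← mul_assoc, Ring.mul_inverse_cancel _ hu, one_mul]
    have hr : (q • (Ring.inverse (a • Φ.K q - a⁻¹ • Φ.B q) * (Φ.K q - Φ.B q))) *
        (a • Φ.K q - a⁻¹ • Φ.B q) = q⁻¹ • (Φ.K q - Φ.B q) := by
      refine hu.mul_left_cancel ?_
      rw [← mul_assoc, hl, mul_smul_comm, hex, smul_mul_assoc, smul_smul]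
      congr 1
      field_simp
    refine ⟨_, ⟨commutator_of_exchange hq ha ha1 hAK hAB (Ring.mul_inverse_cancel _ hKu)
      (Ring.inverse_mul_cancel _ hKu) (Ring.inverse_mul_cancel _ hu) hl hr, fun n _ v hv => ?_⟩,
      hl, hr⟩
    -- `K` and `B` agree on `K_n`
    rw [TDSystem.Ksub_eq] at hv
    have hv' := IsTDData.mem_splitComp_of_mem hv
    rw [LinearMap.smul_apply, Module.End.mul_apply, LinearMap.sub_apply, hK n v hv'.1,
      hB n v hv'.2, sub_self, map_zero, smul_zero]
  obtain ⟨ψ, hψ, hl, hr⟩ := hex_psi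
  have hspec : Φ.IsPsi q a (Φ.psi q a) := Classical.epsilon_spec ⟨ψ, hψ⟩
  have hψeq : Φ.psi q a = ψ := TDSystem.IsPsi.unique hΦ hspec hψ
  refine ⟨⟨TDSystem.existsUnique_isK hΦ, TDSystem.isK_K hΦ, hKu⟩,
    ⟨TDSystem.existsUnique_isB hΦ, TDSystem.isB_B hΦ, hBu⟩,
    ⟨⟨ψ, hψ, fun Y hY => TDSystem.IsPsi.unique hΦ hY hψ⟩, hspec⟩, ?_⟩
  rw [hψeq]
  -- exchanging `K` with `B` and `a` with `a⁻¹` changes the signs of `a K - a⁻¹ B` and `K - B`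
  have hu' : IsUnit (a⁻¹ • Φ.B q - a • Φ.K q) := by
    rw [← neg_sub]
    exact hu.neg
  have hl' : (a⁻¹ • Φ.B q - a • Φ.K q) * ψ = q • (Φ.B q - Φ.K q) := by
    rw [← neg_sub, neg_mul, hl, ← smul_neg, neg_sub]
  have hr' : ψ * (a⁻¹ • Φ.B q - a • Φ.K q) = q⁻¹ • (Φ.B q - Φ.K q) := by
    rw [← neg_sub, mul_neg, hr, ← smul_neg, neg_sub]
  exact ⟨isFraction_mul_inverse hq hKu hu hr, isFraction_mul_inverse hq hBu hu' hr',
    isFraction_inverse_mul hKu hu hl, isFraction_inverse_mul hBu hu' hl'⟩
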